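/- **Setting.** An *mm-space* is a complete separable metric space $(X,d_X)$ of diameter at most $1$ with a Borel probability measure $\mu_X$ of full support. Let $M_\infty$ be the compact space of infinite symmetric matrices $(d_{i,j})_{i,j\in\mathbb N}$ with entries in $[0,1]$ and zero diagonal, and let $\mathcal P(\cdot)$ denote the space of Borel probability measures with the weak topology. For an mm-space $X$, let $\tau(X)\in\mathcal P(M_\infty)$ be the law of $(d_X(x_i,x_j))_{i,j}$ for an i.i.d. $\mu_X$-random sequence $(x_i)$. For a probability space $(Z,\mu)$ and a measurable $d^*:Z\times Z\to\mathcal P([0,1])$, let $\tau(Z,\mu,d^*)\in\mathcal P(M_\infty)$ be the law of the random matrix obtained by choosing an i.i.d. $\mu$-random sequence $(x_i)$ and then, for $i<j$, independent entries $d_{i,j}=d_{j,i}$ with law $d^*(x_i,x_j)$ (and $d_{i,i}=0$). The triple satisfies the *random triangle inequality* if for $\mu^3$-almost every $(a,b,c)$, independent random lengths $l(a,b),l(b,c),l(a,c)$ with laws $d^*(a,b),d^*(b,c),d^*(a,c)$ almost surely satisfy the three triangle inequalities. It is a *qmm-space* if $Z$ is standard Borel, $d^*(x,x)=\delta_0$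 and $d^*(x,y)=d^*(y,x)$ for all $x,y$, and the random triangle inequality holds. Let $\omega$ be a nonprincipal ultrafilter on $\mathbb N$ and $(X_n)$ a sequence of mm-spaces. Let $\mathbf X$ be their set-theoretic ultraproduct. Call the ultralimits $[\{A_n\}]$ of sequences of Borel sets $A_n\subset X_n$ *internal* sets, with measure $\lim_\omega\mu_{X_n}(A_n)$; a set is null if it is contained in internal sets of arbitrarily small measure; $\mathcal M$ is the $\sigma$-algebra of the sets that differ from an internal set by a null set, and $\mu_{\mathbf X}$ is the resulting probability measure on $\mathcal M$. The same construction for the spaces $X_n\times X_n$ (with $\mu_{X_n}\times\mu_{X_n}$) gives a $\sigma$-algebra $\mathcal M_2\supseteq\mathcal M\times\mathcal M$ and a measure $\mu_{\mathbf X}^2$ on $\mathbf X\times\mathbf X$. Let $\mathbf d([x_n],[y_n])=\lim_\omega d_{X_n}(x_n,y_n)$, and let $\mathbf d^*=E(\mathbf d\mid\mathcal M\times\mathcal M):\mathbf X\times\mathbf X\to\mathcal P([0,1])$ be (any version of) its Radon–Nikodym–Dunford–Pettis derivative, i.e. $\mathbf d^*$ is $\mathcal M\times\mathcal M$-measurable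 and $\int_B\langle\mathbf d^*,G\rangle\,d\mu_{\mathbf X}^2=\int_B G(\mathbf d)\,d\mu_{\mathbf X}^2$ for all $G\in C([0,1])$ and $B\in\mathcal M\times\mathcal M$. A *separable realization* of $\mathbf d^*$ consists of a measurable map $\Psi:(\mathbf X,\mathcal M)\to[0,1]$, the measure $\mu_X=\Psi_*\mu_{\mathbf X}$, and a Borel function $d_X^*:[0,1]^2\to\mathcal P([0,1])$ with $d_X^*(\Psi(\mathbf x),\Psi(\mathbf y))=\mathbf d^*(\mathbf x,\mathbf y)$ for $\mu_{\mathbf X}^2$-almost all $(\mathbf x,\mathbf y)$. **Proposition.** For every separable realization $([0,1],\mu_X,d_X^*)$: 1. $\lim_\omega\tau(X_n)=\tau([0,1],\mu_X,d_X^*)$ weakly in $\mathcal P(M_\infty)$; 2. $d_X^*(x,y)=d_X^*(y,x)$ for $\mu_X^2$-almost all $(x,y)$, and $([0,1],\mu_X,d_X^*)$ satisfies the random triangle inequality. Consequently: (a) if $d_X^*(x,x)=\delta_0$ and $d_X^*(x,y)=d_X^*(y,x)$ for all $x,y$, then $([0,1],\mu_X,d_X^*)$ is a qmm-space; (b) more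 generally, if $d_X^*(x,x)=\delta_0$ at every atom $x$ of $\mu_X$, then there is $d'=d_X^*$ $\mu_X^2$-almost everywhere such that $([0,1],\mu_X,d')$ is a qmm-space. -/

import Mathlib

open MeasureTheory Filter Topology Set
open scoped unitInterval ENNReal symmDiff

noncomputable section

namespace UltraMM

/-! ### Ultraproducts of probability spaces -/

/-- An ultrafilter on `ℕ` that is not principal. -/
class Nonprincipal (ω : Ultrafilter ℕ) : Prop where
  ne_pure : ∀ n : ℕ, ω ≠ pure n

theorem eventually_ge (ω : Ultrafilter ℕ) [Nonprincipal ω] (k : ℕ) : ∀ᶠ n in ω, k ≤ n := by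
  by_contra h
  have h' : {n | ¬ k ≤ n} ∈ ω := Ultrafilter.eventually_not.2 h
  have hf : {n : ℕ | ¬ k ≤ n}.Finite := (Set.finite_lt_nat k).subset fun n hn => by simpa using hn
  obtain ⟨x, -, hx⟩ := Ultrafilter.eq_pure_of_finite_mem hf h'
  exact Nonprincipal.ne_pure x hx

/-- The set-theoretic ultraproduct: sequences modulo equality along `ω`. -/
def UltraProduct (ω : Ultrafilter ℕ) (Y : ℕ → Type*) : Type _ :=
  Filter.Product (ω : Filter ℕ) Y

section Loeb

variable {ω : Ultrafilter ℕ} {Y : ℕ → Type*}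

/-- The class of a sequence in the ultraproduct. -/
def UltraProduct.mk (ω : Ultrafilter ℕ) (y : ∀ n, Y n) : UltraProduct ω Y :=
  Quotient.mk (productSetoid (ω : Filter ℕ) Y) y

theorem UltraProduct.exists_mk (p : UltraProduct ω Y) : ∃ y, UltraProduct.mk ω y = p :=
  Quotient.exists_rep p

/-- The ultralimit of a sequence of sets: `[y] ∈ lim_ω A_n` iff `y_n ∈ A_n` for `ω`-almost all
`n`. -/
def internalSet (ω : Ultrafilter ℕ) (A : ∀ n, Set (Y n)) : Set (UltraProduct ω Y) :=
  fun p => Quotient.liftOn p (fun y => ∀ᶠ n in ω, y n ∈ A n) fun y z h => by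
    have h' : ∀ᶠ n in (ω : Filter ℕ), y n = z n := h
    exact propext (eventually_congr (h'.mono fun n hn => by rw [hn]))

theorem mk_mem_internalSet (A : ∀ n, Set (Y n)) (y : ∀ n, Y n) :
    UltraProduct.mk ω y ∈ internalSet ω A ↔ ∀ᶠ n in ω, y n ∈ A n := Iff.rfl

theorem internalSet_mono {A B : ∀ n, Set (Y n)} (h : ∀ᶠ n in ω, A n ⊆ B n) :
    internalSet ω A ⊆ internalSet ω B := by
  intro p hp
  obtain ⟨y, rfl⟩ := p.exists_mk
  rw [mk_mem_internalSet] at *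
  filter_upwards [h, hp] with n h1 h2 using h1 h2

theorem internalSet_compl (A : ∀ n, Set (Y n)) :
    internalSet ω (fun n => (A n)ᶜ) = (internalSet ω A)ᶜ := by
  ext p
  obtain ⟨y, rfl⟩ := p.exists_mk
  rw [Set.mem_compl_iff, mk_mem_internalSet, mk_mem_internalSet]
  exact Ultrafilter.eventually_not

theorem internalSet_union (A B : ∀ n, Set (Y n)) :
    internalSet ω (fun n => A n ∪ B n) = internalSet ω A ∪ internalSet ω B := by
  ext p
  obtain ⟨y, rfl⟩ := p.exists_mk
  rw [Set.mem_union, mk_mem_internalSet, mk_mem_internalSet, mk_mem_internalSet]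
  exact Ultrafilter.eventually_or

theorem internalSet_inter (A B : ∀ n, Set (Y n)) :
    internalSet ω (fun n => A n ∩ B n) = internalSet ω A ∩ internalSet ω B := by
  ext p
  obtain ⟨y, rfl⟩ := p.exists_mk
  rw [Set.mem_inter_iff, mk_mem_internalSet, mk_mem_internalSet, mk_mem_internalSet]
  exact eventually_and

theorem internalSet_diff (A B : ∀ n, Set (Y n)) :
    internalSet ω (fun n => A n \ B n) = internalSet ω A \ internalSet ω B := by
  simp only [Set.sdiff_eq]
  rw [internalSet_inter, internalSet_compl]

theorem internalSet_empty : internalSet ω (fun n => (∅ : Set (Y n))) = ∅ := by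
  ext p
  obtain ⟨y, rfl⟩ := p.exists_mk
  rw [mk_mem_internalSet]
  simp [ω.neBot.ne]

theorem internalSet_univ : internalSet ω (fun n => (Set.univ : Set (Y n))) = Set.univ := by
  ext p
  obtain ⟨y, rfl⟩ := p.exists_mk
  rw [mk_mem_internalSet]
  simp

variable [∀ n, MeasureSpace (Y n)]

/-- The finitely additive measure on ultralimit sets: `lim_ω μ_n(A_n)`. -/
def limMeasure (ω : Ultrafilter ℕ) (A : ∀ n, Set (Y n)) : ℝ≥0∞ :=
  limUnder (ω : Filter ℕ) fun n => volume (A n)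

theorem tendsto_limMeasure (A : ∀ n, Set (Y n)) :
    Tendsto (fun n => (volume (A n) : ℝ≥0∞)) ω (𝓝 (limMeasure ω A)) :=
  Ultrafilter.le_nhds_lim (ω.map fun n => (volume (A n) : ℝ≥0∞))

theorem limMeasure_eq {A : ∀ n, Set (Y n)} {a : ℝ≥0∞}
    (h : Tendsto (fun n => (volume (A n) : ℝ≥0∞)) ω (𝓝 a)) : limMeasure ω A = a :=
  tendsto_nhds_unique (tendsto_limMeasure A) h

theorem limMeasure_mono_eventually {A B : ∀ n, Set (Y n)} (h : ∀ᶠ n in ω, A n ⊆ B n) :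
    limMeasure ω A ≤ limMeasure ω B :=
  le_of_tendsto_of_tendsto (tendsto_limMeasure A) (tendsto_limMeasure B)
    (h.mono fun _ hn => measure_mono hn)

theorem limMeasure_union_le (A B : ∀ n, Set (Y n)) :
    limMeasure ω (fun n => A n ∪ B n) ≤ limMeasure ω A + limMeasure ω B :=
  le_of_tendsto_of_tendsto (tendsto_limMeasure _)
    ((tendsto_limMeasure A).add (tendsto_limMeasure B))
    (Eventually.of_forall fun _ => measure_union_le _ _)

theorem limMeasure_union_add_inter (A : ∀ n, Set (Y n)) {B : ∀ n, Set (Y n)}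
    (hB : ∀ n, MeasurableSet (B n)) :
    limMeasure ω (fun n => A n ∪ B n) + limMeasure ω (fun n => A n ∩ B n)
      = limMeasure ω A + limMeasure ω B := by
  refine tendsto_nhds_unique ((tendsto_limMeasure _).add (tendsto_limMeasure _)) ?_
  simp only [measure_union_add_inter _ (hB _)]
  exact (tendsto_limMeasure A).add (tendsto_limMeasure B)

theorem limMeasure_empty : limMeasure ω (fun n => (∅ : Set (Y n))) = 0 :=
  limMeasure_eq (by simp)

/-- A set is null if it is covered by measurable ultralimit sets of arbitrarily small measure. -/
def IsNull (ω : Ultrafilter ℕ) (N : Set (UltraProduct ω Y)) : Prop :=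
  ∀ ε : ℝ≥0∞, 0 < ε → ∃ A : ∀ n, Set (Y n),
    (∀ n, MeasurableSet (A n)) ∧ N ⊆ internalSet ω A ∧ limMeasure ω A < ε

/-- A set is measurable if it differs from a measurable ultralimit set by a null set. -/
def IsLoebMeasurable (ω : Ultrafilter ℕ) (M : Set (UltraProduct ω Y)) : Prop :=
  ∃ P : ∀ n, Set (Y n), (∀ n, MeasurableSet (P n)) ∧ IsNull ω (M ∆ internalSet ω P)

theorem IsNull.mono {N N' : Set (UltraProduct ω Y)} (h : IsNull ω N) (hs : N' ⊆ N) :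
    IsNull ω N' := fun ε hε => by
  obtain ⟨A, hA, hN, hl⟩ := h ε hε
  exact ⟨A, hA, hs.trans hN, hl⟩

theorem isNull_empty : IsNull ω (∅ : Set (UltraProduct ω Y)) := fun ε hε =>
  ⟨fun _ => ∅, fun _ => .empty, by simp, by rwa [limMeasure_empty]⟩

theorem limMeasure_partial_le (A : ℕ → ∀ n, Set (Y n)) (k : ℕ) :
    limMeasure ω (fun n => ⋃ j ∈ Finset.range k, A j n)
      ≤ ∑ j ∈ Finset.range k, limMeasure ω (A j) :=
  le_of_tendsto_of_tendsto (tendsto_limMeasure _)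
    (tendsto_finsetSum _ fun j _ => tendsto_limMeasure (A j))
    (Eventually.of_forall fun _ => measure_biUnion_finset_le _ _)

/-- Countable saturation: a countable union of ultralimit sets is contained in an ultralimit set
of no larger measure. -/
theorem exists_internal_cover [Nonprincipal ω] [∀ n, IsProbabilityMeasure (volume : Measure (Y n))]
    (A : ℕ → ∀ n, Set (Y n)) (hA : ∀ j n, MeasurableSet (A j n)) :
    ∃ Q : ∀ n, Set (Y n), (∀ n, MeasurableSet (Q n)) ∧
      (∀ k, internalSet ω (fun n => ⋃ j ∈ Finset.range k, A j n) ⊆ internalSet ω Q) ∧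
      limMeasure ω Q ≤ ⨆ k, limMeasure ω (fun n => ⋃ j ∈ Finset.range k, A j n) := by
  classical
  set B : ℕ → ∀ n, Set (Y n) := fun k n => ⋃ j ∈ Finset.range k, A j n with hB
  have hBm : ∀ k n, MeasurableSet (B k n) := fun k n =>
    Finset.measurableSet_biUnion _ fun j _ => hA j n
  have hmono : ∀ n k l, k ≤ l → B k n ⊆ B l n := fun n k l hkl =>
    Set.biUnion_subset_biUnion_left fun j hj => by
      simp only [Finset.coe_range, Set.mem_Iio] at hj ⊢
      exact hj.trans_le hkl
  set s := ⨆ k, limMeasure ω (B k) with hs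
  set c : ℕ → ℝ≥0∞ := fun k => ((k : ℝ≥0∞) + 1)⁻¹ with hc
  have hc0 : ∀ k, 0 < c k := fun k => by
    simp only [hc, ENNReal.inv_pos]
    exact ENNReal.add_ne_top.2 ⟨ENNReal.natCast_ne_top k, ENNReal.one_ne_top⟩
  have hcanti : ∀ k l, k ≤ l → c l ≤ c k := fun k l hkl => by
    simp only [hc, ENNReal.inv_le_inv]
    gcongr
  have hle1 : ∀ k, limMeasure ω (B k) ≤ 1 := fun k =>
    le_of_tendsto (tendsto_limMeasure _) (Eventually.of_forall fun n => prob_le_one)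
  let S : ℕ → ℕ → Prop := fun n k => volume (B k n) ≤ s + c k
  let h : ℕ → ℕ := fun n => Nat.findGreatest (S n) n
  have hS0 : ∀ n, S n 0 := fun n => by simp [S, hB]
  have hSh : ∀ n, S n (h n) := fun n => Nat.findGreatest_spec (P := S n) (Nat.zero_le n) (hS0 n)
  have hSev : ∀ k, ∀ᶠ n in ω, S n k := fun k => by
    have hk : limMeasure ω (B k) < s + c k :=
      lt_of_lt_of_le (ENNReal.lt_add_right (ne_top_of_le_ne_top ENNReal.one_ne_top (hle1 k))
        (hc0 k).ne') (by gcongr; exact le_iSup (fun k => limMeasure ω (B k)) k)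
    exact ((tendsto_limMeasure (B k)).eventually (gt_mem_nhds hk)).mono fun n hn => le_of_lt hn
  have hge : ∀ k, ∀ᶠ n in ω, k ≤ h n := fun k => by
    filter_upwards [hSev k, eventually_ge ω k] with n h1 h2
    exact Nat.le_findGreatest h2 h1
  refine ⟨fun n => B (h n) n, fun n => hBm _ _, fun k => ?_, ?_⟩
  · exact internalSet_mono ((hge k).mono fun n hn => hmono n _ _ hn)
  · have hk : ∀ k, limMeasure ω (fun n => B (h n) n) ≤ s + c k := fun k =>
      le_of_tendsto (tendsto_limMeasure _) ((hge k).mono fun n hn =>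
        (hSh n).trans (by gcongr; exact hcanti _ _ hn))
    have hlim : Tendsto (fun k => s + c k) atTop (𝓝 (s + 0)) := by
      refine tendsto_const_nhds.add ?_
      have := (tendsto_add_atTop_iff_nat (f := fun k : ℕ => ((k : ℝ≥0∞))⁻¹) 1).2
        ENNReal.tendsto_inv_nat_nhds_zero
      simpa [hc] using this
    rw [add_zero] at hlim
    exact ge_of_tendsto' hlim hk

section Prob

variable [Nonprincipal ω] [∀ n, IsProbabilityMeasure (volume : Measure (Y n))]

theorem limMeasure_mono {A B : ∀ n, Set (Y n)} (h : internalSet ω A ⊆ internalSet ω B) :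
    limMeasure ω A ≤ limMeasure ω B := by
  classical
  refine limMeasure_mono_eventually ?_
  by_contra hcon
  have hcon' : ∀ᶠ n in ω, ¬ A n ⊆ B n := Ultrafilter.eventually_not.2 hcon
  have hne : ∀ n, Nonempty (Y n) := fun n => nonempty_of_isProbabilityMeasure volume
  let y : ∀ n, Y n := fun n =>
    if hn : ∃ z, z ∈ A n ∧ z ∉ B n then hn.choose else (hne n).some
  have hy : ∀ᶠ n in ω, y n ∈ A n ∧ y n ∉ B n := by
    filter_upwards [hcon'] with n hn
    have hn' : ∃ z, z ∈ A n ∧ z ∉ B n := Set.not_subset.1 hn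
    simp only [y, dif_pos hn']
    exact hn'.choose_spec
  have h1 : UltraProduct.mk ω y ∈ internalSet ω A := hy.mono fun n hn => hn.1
  have h2 := (mk_mem_internalSet B y).1 (h h1)
  obtain ⟨n, hn, hn'⟩ := (hy.and h2).exists
  exact hn.2 hn'

theorem limMeasure_eq_zero {A : ∀ n, Set (Y n)} (h : IsNull ω (internalSet ω A)) :
    limMeasure ω A = 0 := by
  by_contra hne
  obtain ⟨B, -, hAB, hl⟩ := h _ (pos_iff_ne_zero.2 hne)
  exact absurd (limMeasure_mono hAB) (not_le.2 hl)

theorem limMeasure_le_of_null {P Q : ∀ n, Set (Y n)}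
    (h : IsNull ω (internalSet ω P \ internalSet ω Q)) : limMeasure ω P ≤ limMeasure ω Q := by
  rw [← internalSet_diff] at h
  calc limMeasure ω P ≤ limMeasure ω (fun n => (P n \ Q n) ∪ Q n) :=
        limMeasure_mono_eventually (Eventually.of_forall fun n => by simp)
    _ ≤ _ := limMeasure_union_le _ _
    _ = limMeasure ω Q := by rw [limMeasure_eq_zero h, zero_add]

theorem isNull_iUnion {N : ℕ → Set (UltraProduct ω Y)} (h : ∀ k, IsNull ω (N k)) :
    IsNull ω (⋃ k, N k) := by
  intro ε hε
  obtain ⟨δ, hδ, hsum⟩ := ENNReal.exists_pos_sum_of_countable' hε.ne' ℕ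
  choose A hA hN hl using fun k => h k (δ k) (hδ k)
  obtain ⟨Q, hQ, hsub, hle⟩ := exists_internal_cover (ω := ω) A hA
  refine ⟨Q, hQ, Set.iUnion_subset fun k => (hN k).trans ?_, lt_of_le_of_lt ?_ hsum⟩
  · refine Set.Subset.trans (internalSet_mono (Eventually.of_forall fun n => ?_)) (hsub (k + 1))
    exact Set.subset_biUnion_of_mem (u := fun j => A j n) (by simp)
  · refine hle.trans (iSup_le fun k => (limMeasure_partial_le A k).trans ?_)
    exact (Finset.sum_le_sum fun j _ => (hl j).le).trans (ENNReal.sum_le_tsum _)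

theorem IsNull.union {N N' : Set (UltraProduct ω Y)} (h : IsNull ω N) (h' : IsNull ω N') :
    IsNull ω (N ∪ N') := by
  refine (isNull_iUnion (N := fun k => if k = 0 then N else N') fun k => ?_).mono ?_
  · by_cases hk : k = 0 <;> simp [hk, h, h']
  · rintro x (hx | hx)
    · exact Set.mem_iUnion.2 ⟨0, by simpa using hx⟩
    · exact Set.mem_iUnion.2 ⟨1, by simpa using hx⟩

/-- A countable union of ultralimit sets differs from an ultralimit set by a null set. -/
theorem exists_internal_iUnion (A : ℕ → ∀ n, Set (Y n)) (hA : ∀ j n, MeasurableSet (A j n)) :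
    ∃ Q : ∀ n, Set (Y n), (∀ n, MeasurableSet (Q n)) ∧
      IsNull ω ((⋃ j, internalSet ω (A j)) ∆ internalSet ω Q) ∧
      limMeasure ω Q ≤ ∑' j, limMeasure ω (A j) := by
  obtain ⟨Q, hQ, hsub, hle⟩ := exists_internal_cover (ω := ω) A hA
  set B : ℕ → ∀ n, Set (Y n) := fun k n => ⋃ j ∈ Finset.range k, A j n with hB
  have hBm : ∀ k n, MeasurableSet (B k n) := fun k n =>
    Finset.measurableSet_biUnion _ fun j _ => hA j n
  have hBsub : ∀ k, internalSet ω (B k) ⊆ ⋃ j, internalSet ω (A j) := by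
    intro k
    induction k with
    | zero =>
      simp only [hB, Finset.range_zero, Finset.notMem_empty, Set.iUnion_of_empty,
        Set.iUnion_empty, internalSet_empty, Set.empty_subset]
    | succ k ih =>
      have : B (k + 1) = fun n => A k n ∪ B k n := by
        funext n
        simp only [hB, Finset.range_add_one, Finset.set_biUnion_insert]
      rw [this, internalSet_union]
      exact Set.union_subset (Set.subset_iUnion (fun j => internalSet ω (A j)) k) ih
  have hAsub : (⋃ j, internalSet ω (A j)) ⊆ internalSet ω Q := Set.iUnion_subset fun k => by
    refine Set.Subset.trans (internalSet_mono (Eventually.of_forall fun n => ?_)) (hsub (k + 1))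
    exact Set.subset_biUnion_of_mem (u := fun j => A j n) (by simp)
  refine ⟨Q, hQ, ?_, hle.trans (iSup_le fun k =>
    (limMeasure_partial_le A k).trans (ENNReal.sum_le_tsum _))⟩
  intro ε hε
  have hQ1 : limMeasure ω Q ≤ 1 :=
    le_of_tendsto (tendsto_limMeasure _) (Eventually.of_forall fun n => prob_le_one)
  have hex : ∃ k, limMeasure ω Q < limMeasure ω (B k) + ε := by
    by_contra! hcon
    by_cases hε' : ε = ⊤
    · have := hcon 0
      simp only [hε', add_top, top_le_iff] at this
      exact ENNReal.one_ne_top (top_le_iff.1 (this ▸ hQ1))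
    have h1 : (⨆ k, limMeasure ω (B k)) + ε ≤ limMeasure ω Q := by
      rw [ENNReal.iSup_add]
      exact iSup_le hcon
    have h2 : limMeasure ω Q + ε ≤ limMeasure ω Q := le_trans (by gcongr) h1
    exact absurd h2 (not_le.2 (ENNReal.lt_add_right
      (ne_top_of_le_ne_top ENNReal.one_ne_top hQ1) hε.ne'))
  obtain ⟨k, hk⟩ := hex
  refine ⟨fun n => Q n \ B k n, fun n => (hQ n).diff (hBm k n), ?_, ?_⟩
  · rw [internalSet_diff]
    rintro x (⟨hx, hx'⟩ | ⟨hx, hx'⟩)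
    · exact absurd (hAsub hx) hx'
    · exact ⟨hx, fun hb => hx' (hBsub k hb)⟩
  · have hadd := limMeasure_union_add_inter (ω := ω) (fun n => Q n \ B k n) (hBm k)
    have hi : limMeasure ω (fun n => Q n \ B k n ∩ B k n) = 0 := by
      simp only [Set.sdiff_inter_self]
      exact limMeasure_empty
    rw [hi, add_zero] at hadd
    have hu : limMeasure ω (fun n => Q n \ B k n ∪ B k n) ≤ limMeasure ω Q := by
      refine limMeasure_mono ?_
      rw [internalSet_union, internalSet_diff]
      exact Set.union_subset Set.sdiff_subset (hsub k)
    rw [hadd] at hu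
    have hfin : limMeasure ω (B k) ≠ ⊤ := ne_top_of_le_ne_top ENNReal.one_ne_top
      (le_of_tendsto (tendsto_limMeasure _) (Eventually.of_forall fun n => prob_le_one))
    have h3 : limMeasure ω (B k) + limMeasure ω (fun n => Q n \ B k n)
        < limMeasure ω (B k) + ε := by
      rw [add_comm]
      exact hu.trans_lt hk
    exact (ENNReal.add_lt_add_iff_left hfin).1 h3

theorem isLoebMeasurable_iUnion {M : ℕ → Set (UltraProduct ω Y)} {P : ℕ → ∀ n, Set (Y n)}
    (hP : ∀ j n, MeasurableSet (P j n)) (hM : ∀ j, IsNull ω (M j ∆ internalSet ω (P j))) :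
    ∃ Q : ∀ n, Set (Y n), (∀ n, MeasurableSet (Q n)) ∧ IsNull ω ((⋃ j, M j) ∆ internalSet ω Q) ∧
      limMeasure ω Q ≤ ∑' j, limMeasure ω (P j) := by
  obtain ⟨Q, hQ, hN, hle⟩ := exists_internal_iUnion (ω := ω) P hP
  refine ⟨Q, hQ, ((isNull_iUnion hM).union hN).mono ?_, hle⟩
  refine (symmDiff_triangle (⋃ j, M j) (⋃ j, internalSet ω (P j)) (internalSet ω Q)).trans ?_
  refine sup_le_sup_right ?_ _
  rintro x (⟨hx, hx'⟩ | ⟨hx, hx'⟩)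
  · obtain ⟨j, hj⟩ := Set.mem_iUnion.1 hx
    exact Set.mem_iUnion.2 ⟨j, Or.inl ⟨hj, fun h => hx' (Set.mem_iUnion.2 ⟨j, h⟩)⟩⟩
  · obtain ⟨j, hj⟩ := Set.mem_iUnion.1 hx
    exact Set.mem_iUnion.2 ⟨j, Or.inr ⟨hj, fun h => hx' (Set.mem_iUnion.2 ⟨j, h⟩)⟩⟩

/-- The `σ`-algebra of measurable sets of the ultraproduct. -/
instance : MeasurableSpace (UltraProduct ω Y) where
  MeasurableSet' := IsLoebMeasurable ω
  measurableSet_empty := ⟨fun _ => ∅, fun _ => .empty, by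
    rw [internalSet_empty, symmDiff_self]
    exact isNull_empty⟩
  measurableSet_compl := by
    rintro M ⟨P, hP, hM⟩
    refine ⟨fun n => (P n)ᶜ, fun n => (hP n).compl, ?_⟩
    rw [internalSet_compl, compl_symmDiff_compl]
    exact hM
  measurableSet_iUnion := by
    intro M hM
    choose P hP hN using hM
    obtain ⟨Q, hQ, hN', -⟩ := isLoebMeasurable_iUnion hP hN
    exact ⟨Q, hQ, hN'⟩

/-- The value `lim_ω μ_n(P_n)` for any `P` whose ultralimit differs from `M` by a null set. -/
def loebValue (M : Set (UltraProduct ω Y)) (hM : IsLoebMeasurable ω M) : ℝ≥0∞ :=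
  limMeasure ω hM.choose

theorem loebValue_eq {M : Set (UltraProduct ω Y)} (hM : IsLoebMeasurable ω M)
    {P : ∀ n, Set (Y n)} (h : IsNull ω (M ∆ internalSet ω P)) :
    loebValue M hM = limMeasure ω P := by
  have h' := hM.choose_spec.2
  have key : IsNull ω (internalSet ω hM.choose ∆ internalSet ω P) := (h'.union h).mono (by
    have := symmDiff_triangle (internalSet ω hM.choose) M (internalSet ω P)
    rwa [symmDiff_comm (internalSet ω hM.choose) M] at this)
  exact le_antisymm (limMeasure_le_of_null (key.mono fun x hx => Or.inl hx))
    (limMeasure_le_of_null (key.mono fun x hx => Or.inr hx))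

theorem loebValue_mono {M N : Set (UltraProduct ω Y)} (hM : IsLoebMeasurable ω M)
    (hN : IsLoebMeasurable ω N) (h : M ⊆ N) : loebValue M hM ≤ loebValue N hN := by
  refine limMeasure_le_of_null ((hM.choose_spec.2.union hN.choose_spec.2).mono ?_)
  rintro x ⟨hx, hx'⟩
  by_cases hxM : x ∈ M
  · exact Or.inr (Or.inl ⟨h hxM, hx'⟩)
  · exact Or.inl (Or.inr ⟨hx, hxM⟩)

theorem loebValue_union {M N : Set (UltraProduct ω Y)} (hM : IsLoebMeasurable ω M)
    (hN : IsLoebMeasurable ω N) (hd : Disjoint M N) (hMN : IsLoebMeasurable ω (M ∪ N)) :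
    loebValue (M ∪ N) hMN = loebValue M hM + loebValue N hN := by
  obtain ⟨P, hP, hP'⟩ := id hM
  obtain ⟨Q, hQ, hQ'⟩ := id hN
  have hU : IsNull ω ((M ∪ N) ∆ internalSet ω fun n => P n ∪ Q n) := by
    rw [internalSet_union]
    refine (hP'.union hQ').mono ?_
    rintro x (⟨hx, hx'⟩ | ⟨hx, hx'⟩)
    · rw [Set.mem_union, not_or] at hx'
      exact hx.imp (fun h => Or.inl ⟨h, hx'.1⟩) (fun h => Or.inl ⟨h, hx'.2⟩)
    · rw [Set.mem_union, not_or] at hx'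
      exact hx.imp (fun h => Or.inr ⟨h, hx'.1⟩) (fun h => Or.inr ⟨h, hx'.2⟩)
  have hI : IsNull ω (internalSet ω fun n => P n ∩ Q n) := by
    rw [internalSet_inter]
    refine (hP'.union hQ').mono ?_
    rintro x ⟨hx, hx'⟩
    by_cases hxM : x ∈ M
    · exact Or.inr (Or.inr ⟨hx', Set.disjoint_left.1 hd hxM⟩)
    · exact Or.inl (Or.inr ⟨hx, hxM⟩)
  rw [loebValue_eq hM hP', loebValue_eq hN hQ', loebValue_eq hMN hU,
    ← limMeasure_union_add_inter P hQ, limMeasure_eq_zero hI, add_zero]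

theorem loebValue_iUnion {M : ℕ → Set (UltraProduct ω Y)} (hM : ∀ j, IsLoebMeasurable ω (M j))
    (hd : Pairwise (Function.onFun Disjoint M)) (hU : IsLoebMeasurable ω (⋃ j, M j)) :
    loebValue (⋃ j, M j) hU = ∑' j, loebValue (M j) (hM j) := by
  refine le_antisymm ?_ ?_
  · choose P hP hN using id hM
    obtain ⟨Q, hQ, hN', hle⟩ := isLoebMeasurable_iUnion hP hN
    rw [loebValue_eq hU hN']
    refine hle.trans (le_of_eq (tsum_congr fun j => ?_))
    rw [loebValue_eq _ (hN j)]
  · have hfin : ∀ k, IsLoebMeasurable ω (⋃ j ∈ Finset.range k, M j) := fun k =>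
      show MeasurableSet (⋃ j ∈ Finset.range k, M j) from
        Finset.measurableSet_biUnion _ fun j _ => hM j
    have hsum : ∀ k, ∑ j ∈ Finset.range k, loebValue (M j) (hM j) =
        loebValue (⋃ j ∈ Finset.range k, M j) (hfin k) := by
      intro k
      induction k with
      | zero =>
        have : IsNull ω ((⋃ j ∈ Finset.range 0, M j) ∆ internalSet ω fun n => (∅ : Set (Y n))) := by
          simpa [internalSet_empty] using isNull_empty
        rw [loebValue_eq _ this, limMeasure_empty, Finset.sum_range_zero]
      | succ k ih =>
        have hEq : (⋃ j ∈ Finset.range (k + 1), M j) = M k ∪ ⋃ j ∈ Finset.range k, M j := by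
          simp [Finset.range_add_one]
        have hdk : Disjoint (M k) (⋃ j ∈ Finset.range k, M j) := by
          refine Set.disjoint_iUnion₂_right.2 fun j hj => hd ?_
          exact (Finset.mem_range.1 hj).ne'
        have hk' : IsLoebMeasurable ω (M k ∪ ⋃ j ∈ Finset.range k, M j) := hEq ▸ hfin (k + 1)
        rw [Finset.sum_range_succ, ih, add_comm, ← loebValue_union (hM k) (hfin k) hdk hk']
        congr 1
        exact hEq.symm
    rw [ENNReal.tsum_eq_iSup_nat]
    refine iSup_le fun k => ?_
    rw [hsum]
    exact loebValue_mono _ _ (Set.iUnion₂_subset fun j _ => Set.subset_iUnion M j)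

/-- The ultraproduct measure. -/
instance : MeasureSpace (UltraProduct ω Y) where
  volume := Measure.ofMeasurable loebValue
    (by
      have : IsNull ω ((∅ : Set (UltraProduct ω Y)) ∆ internalSet ω fun n => (∅ : Set (Y n))) := by
        simpa [internalSet_empty] using isNull_empty
      exact (loebValue_eq _ this).trans limMeasure_empty)
    (fun _ hM hd => loebValue_iUnion hM hd _)

theorem volume_eq_limMeasure {M : Set (UltraProduct ω Y)} {P : ∀ n, Set (Y n)}
    (hP : ∀ n, MeasurableSet (P n)) (h : IsNull ω (M ∆ internalSet ω P)) :
    volume M = limMeasure ω P := by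
  have hM : IsLoebMeasurable ω M := ⟨P, hP, h⟩
  rw [← loebValue_eq hM h]
  exact Measure.ofMeasurable_apply M hM

instance : IsProbabilityMeasure (volume : Measure (UltraProduct ω Y)) where
  measure_univ := by
    rw [volume_eq_limMeasure (P := fun n => (Set.univ : Set (Y n))) (fun _ => .univ)
      (by rw [internalSet_univ, symmDiff_self]; exact isNull_empty)]
    exact limMeasure_eq (by simp)

end Prob

end Loeb

/-! ### Distance matrices and metric measure spaces -/

/-- The space `M_∞` of infinite symmetric matrices with entries in `[0,1]` and zero diagonal. -/
abbrev DistMatrix : Type := {m : ℕ → ℕ → I // (∀ i j, m i j = m j i) ∧ ∀ i, m i i = 0}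

/-- A metric measure space: a Polish (complete separable) metric space of diameter at most one with
a Borel probability measure of full support. -/
structure MMSpace where
  /-- The underlying set. -/
  carrier : Type*
  [metricSpace : MetricSpace carrier]
  [measureSpace : MeasureSpace carrier]
  [borelSpace : BorelSpace carrier]
  [completeSpace : CompleteSpace carrier]
  [separable : SecondCountableTopology carrier]
  [isProb : IsProbabilityMeasure (volume : Measure carrier)]
  [fullSupport : (volume : Measure carrier).IsOpenPosMeasure]
  dist_le_one : ∀ x y : carrier, dist x y ≤ 1

namespace MMSpace

instance : CoeSort MMSpace (Type _) := ⟨MMSpace.carrier⟩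

attribute [instance] metricSpace measureSpace borelSpace completeSpace separable isProb fullSupport

/-- The distance as an element of `[0,1]`. -/
def distI (X : MMSpace) (x y : X) : I := ⟨dist x y, dist_nonneg, X.dist_le_one x y⟩

/-- The distance matrix of a sequence of points. -/
def matrixOf (X : MMSpace) (x : ℕ → X) : DistMatrix :=
  ⟨fun i j => X.distI (x i) (x j), fun _ _ => Subtype.ext (dist_comm _ _),
    fun _ => Subtype.ext (dist_self _)⟩

theorem measurable_matrixOf (X : MMSpace) : Measurable X.matrixOf := by
  refine Measurable.subtype_mk (measurable_pi_lambda _ fun i => measurable_pi_lambda _ fun j => ?_)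
  refine Measurable.subtype_mk ?_
  exact (measurable_pi_apply i).dist (measurable_pi_apply j)

/-- The sampling measure `τ(X)` of an mm-space: the law of the distance matrix of an i.i.d.
sequence of points. -/
def sampling (X : MMSpace) : ProbabilityMeasure DistMatrix :=
  ⟨(Measure.infinitePi fun _ : ℕ => (volume : Measure X)).map X.matrixOf,
    Measure.isProbabilityMeasure_map X.measurable_matrixOf.aemeasurable⟩

end MMSpace

/-! ### Quantum metric measure spaces and their sampling measures -/

/-- The point mass at `t`, as an element of the space `P[0,1]` of probability measures. -/
def diracI (t : I) : ProbabilityMeasure I := ⟨Measure.dirac t, inferInstance⟩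

/-- The triangle inequality of a `P[0,1]`-valued distance: for almost all triples `(a,b,c)`,
independent random lengths with laws `d a b`, `d b c`, `d a c` almost surely satisfy the three
triangle inequalities. -/
def RandomTriangle {Ω : Type*} [MeasurableSpace Ω] (μ : ProbabilityMeasure Ω)
    (d : Ω → Ω → ProbabilityMeasure I) : Prop :=
  ∀ᵐ p : Ω × Ω × Ω ∂((μ : Measure Ω).prod ((μ : Measure Ω).prod (μ : Measure Ω))),
    ∀ᵐ l : I × I × I ∂((d p.1 p.2.1 : Measure I).prod
        ((d p.2.1 p.2.2 : Measure I).prod (d p.1 p.2.2 : Measure I))),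
      (l.2.2 : ℝ) ≤ l.1 + l.2.1 ∧ (l.1 : ℝ) ≤ l.2.1 + l.2.2 ∧ (l.2.1 : ℝ) ≤ l.1 + l.2.2

/-- Quantum metric measure spaces. -/
structure IsQMM {Ω : Type*} [MeasurableSpace Ω] [StandardBorelSpace Ω] (μ : ProbabilityMeasure Ω)
    (d : Ω → Ω → ProbabilityMeasure I) : Prop where
  measurable : Measurable (Function.uncurry d)
  diag : ∀ x, d x x = diracI 0
  symm : ∀ x y, d x y = d y x
  triangle : RandomTriangle μ d

/-- The pairs `i < j`. -/
abbrev Pairs : Type := {p : ℕ × ℕ // p.1 < p.2}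

/-- The symmetric matrix with zero diagonal and given entries above the diagonal. -/
def assemble (l : Pairs → I) : DistMatrix :=
  ⟨fun i j => if h : i < j then l ⟨(i, j), h⟩ else if h' : j < i then l ⟨(j, i), h'⟩ else 0, by
    refine ⟨fun i j => ?_, fun i => by simp⟩
    rcases lt_trichotomy i j with h | h | h
    · simp [h, h.not_gt]
    · simp [h]
    · simp [h, h.not_gt]⟩

theorem measurable_assemble : Measurable assemble := by
  refine Measurable.subtype_mk (measurable_pi_lambda _ fun i => measurable_pi_lambda _ fun j => ?_)
  by_cases h : i < j
  · simpa [h] using measurable_pi_apply (X := fun _ : Pairs => I) ⟨(i, j), h⟩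
  · by_cases h' : j < i
    · simpa [h, h'] using measurable_pi_apply (X := fun _ : Pairs => I) ⟨(j, i), h'⟩
    · simp [h, h']

/-- The probability measure on `M_∞` defined by a matrix of elements of `P[0,1]`: the entries above
the diagonal are chosen independently with the given laws (the diagonal is zero, and the
entries below it are determined by symmetry). -/
def matrixLaw (a : Pairs → ProbabilityMeasure I) : Measure DistMatrix :=
  (Measure.infinitePi fun p => (a p : Measure I)).map assemble

instance (a : Pairs → ProbabilityMeasure I) : IsProbabilityMeasure (matrixLaw a) :=
  Measure.isProbabilityMeasure_map measurable_assemble.aemeasurable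

theorem measurable_infinitePi_param {ι : Type*} :
    Measurable fun a : ι → ProbabilityMeasure I =>
      Measure.infinitePi fun p => (a p : Measure I) := by
  classical
  refine Measurable.measure_of_isPiSystem_of_isProbabilityMeasure
    (S := squareCylinders fun _ : ι => {s : Set I | MeasurableSet s})
    generateFrom_squareCylinders.symm
    (isPiSystem_squareCylinders (fun _ => MeasurableSpace.isPiSystem_measurableSet)
      fun _ => (MeasurableSet.univ : MeasurableSet (Set.univ : Set I))) ?_
  rintro _ ⟨s, t, ht, rfl⟩
  have ht' : ∀ i, MeasurableSet (t i) := fun i => by simpa using ht i (Set.mem_univ i)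
  simp only [Measure.infinitePi_pi _ fun i _ => ht' i]
  refine Finset.measurable_prod s fun i _ => ?_
  exact (Measure.measurable_coe (ht' i)).comp
    (measurable_subtype_coe.comp (measurable_pi_apply i))

theorem measurable_matrixLaw : Measurable matrixLaw :=
  (Measure.measurable_map _ measurable_assemble).comp measurable_infinitePi_param

section QSampling

variable {Ω : Type*} [MeasurableSpace Ω]

/-- The matrix of laws of the distances of a sequence of points. -/
def qMatrixOf (d : Ω → Ω → ProbabilityMeasure I) (x : ℕ → Ω) : Pairs → ProbabilityMeasure I :=
  fun p => d (x p.1.1) (x p.1.2)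

theorem measurable_qMatrixOf {d : Ω → Ω → ProbabilityMeasure I}
    (hd : Measurable (Function.uncurry d)) : Measurable (qMatrixOf d) :=
  measurable_pi_lambda _ fun p =>
    show Measurable fun x : ℕ → Ω => Function.uncurry d (x p.1.1, x p.1.2) from hd.comp ((measurable_pi_apply p.1.1).prodMk (measurable_pi_apply p.1.2))

/-- The sampling measure `τ(Ω, μ, d)`: the barycenter of the law of the random element of `P(M_∞)`
given by the matrix `d (x i) (x j)`, for an i.i.d. `μ`-random sequence of points `x i`. -/
def qSampling (μ : ProbabilityMeasure Ω) (d : Ω → Ω → ProbabilityMeasure I)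
    (hd : Measurable (Function.uncurry d)) : ProbabilityMeasure DistMatrix :=
  ⟨Measure.join ((Measure.infinitePi fun _ : ℕ => (μ : Measure Ω)).map
      fun x => matrixLaw (qMatrixOf d x)),
    isProbabilityMeasure_bind (measurable_matrixLaw.comp (measurable_qMatrixOf hd)).aemeasurable
      (Eventually.of_forall fun _ => inferInstance)⟩

end QSampling

/-! ### The ultralimit distance, its derivative and separable realizations -/

/-- The Radon-Nikodym-Dunford-Pettis derivative `E(f | 𝓑)` of the `P[0,1]`-valued function
`x ↦ δ_{f x}`: a `𝓑`-measurable `P[0,1]`-valued function `F` such that, for all continuous `G` and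
all `B ∈ 𝓑`, the functions `⟨F x, G⟩` and `G (f x)` have the same integral over `B`. -/
structure IsRNDPDerivative {Ω : Type*} [MeasurableSpace Ω] (P : Measure Ω) (𝓑 : MeasurableSpace Ω)
    (f : Ω → I) (F : Ω → ProbabilityMeasure I) : Prop where
  measurable : Measurable[𝓑] F
  setIntegral_eq : ∀ (G : C(I, ℝ)) (B : Set Ω), MeasurableSet[𝓑] B →
    ∫ x in B, (∫ t, G t ∂(F x : Measure I)) ∂P = ∫ x in B, G (f x) ∂P

section Realization

variable (ω : Ultrafilter ℕ) (X : ℕ → MMSpace)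

/-- The ultraproduct `𝐗` of a sequence of mm-spaces. -/
abbrev UX : Type _ := UltraProduct ω fun n => (X n : Type _)

/-- The ultraproduct `𝐗²` of the squares, with its own (large) `σ`-algebra and measure. -/
abbrev UX2 : Type _ := UltraProduct ω fun n => (X n × X n : Type _)

variable {ω X}

/-- First coordinate `𝐗² → 𝐗`. -/
def fstU (p : UX2 ω X) : UX ω X :=
  Quotient.map' (fun xy n => (xy n).1)
    (fun xy xy' (h : ∀ᶠ n in (ω : Filter ℕ), xy n = xy' n) => h.mono fun _ hn => by simp only [hn]) p

/-- Second coordinate `𝐗² → 𝐗`. -/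
def sndU (p : UX2 ω X) : UX ω X :=
  Quotient.map' (fun xy n => (xy n).2)
    (fun xy xy' (h : ∀ᶠ n in (ω : Filter ℕ), xy n = xy' n) => h.mono fun _ hn => by simp only [hn]) p

/-- The canonical bijection of `𝐗²` with `𝐗 × 𝐗`. -/
def splitU (p : UX2 ω X) : UX ω X × UX ω X := (fstU p, sndU p)

theorem splitU_bijective : Function.Bijective (splitU : UX2 ω X → UX ω X × UX ω X) := by
  constructor
  · intro p q h
    obtain ⟨x, rfl⟩ := p.exists_mk
    obtain ⟨y, rfl⟩ := q.exists_mk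
    have h1 : ∀ᶠ n in (ω : Filter ℕ), (x n).1 = (y n).1 := Quotient.exact (congrArg Prod.fst h)
    have h2 : ∀ᶠ n in (ω : Filter ℕ), (x n).2 = (y n).2 := Quotient.exact (congrArg Prod.snd h)
    refine Quotient.sound ?_
    show ∀ᶠ n in (ω : Filter ℕ), x n = y n
    filter_upwards [h1, h2] with n a b using Prod.ext a b
  · rintro ⟨p, q⟩
    obtain ⟨x, rfl⟩ := p.exists_mk
    obtain ⟨y, rfl⟩ := q.exists_mk
    exact ⟨UltraProduct.mk ω fun n => (x n, y n), rfl⟩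

/-- The ultralimit distance `𝐝([x], [y]) = lim_ω d_n(x_n, y_n)`. -/
def ultraDist (p : UX2 ω X) : I :=
  Quotient.liftOn p
    (fun xy => limUnder (ω : Filter ℕ) fun n => (X n).distI (xy n).1 (xy n).2)
    fun xy xy' (h : ∀ᶠ n in (ω : Filter ℕ), xy n = xy' n) => by
      have : Filter.map (fun n => (X n).distI (xy n).1 (xy n).2) (ω : Filter ℕ)
          = Filter.map (fun n => (X n).distI (xy' n).1 (xy' n).2) (ω : Filter ℕ) :=
        Filter.map_congr (h.mono fun n hn => by simp only [hn])
      simp only [limUnder, this]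

variable [Nonprincipal ω]

/-- The `σ`-algebra `𝓜 × 𝓜` on `𝐗²` (in general smaller than the `σ`-algebra `𝓜₂` of `𝐗²`). -/
@[reducible] def prodAlgebra : MeasurableSpace (UX2 ω X) :=
  MeasurableSpace.comap splitU (inferInstance : MeasurableSpace (UX ω X × UX ω X))

/-- `dstar` is a version of `𝐝* = E(𝐝 | 𝓜 × 𝓜)`. -/
def IsDerivativeOfDist (dstar : UX2 ω X → ProbabilityMeasure I) : Prop :=
  IsRNDPDerivative (volume : Measure (UX2 ω X)) prodAlgebra ultraDist dstar

/-- A separable realization of `𝐝*`: a measurable map `Ψ : 𝐗 → [0,1]` and a Borel function `d` on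
`[0,1]²` with values in `P[0,1]` whose pull-back by `Ψ` is `𝐝*` (almost everywhere). -/
structure SeparableRealization (dstar : UX2 ω X → ProbabilityMeasure I) where
  Ψ : UX ω X → I
  measurable_Ψ : Measurable Ψ
  d : I → I → ProbabilityMeasure I
  measurable_d : Measurable (Function.uncurry d)
  pullback_eq : ∀ᵐ p : UX2 ω X, d (Ψ (fstU p)) (Ψ (sndU p)) = dstar p

/-- The measure `μ_X` of a separable realization: the push-forward of `μ_𝐗` by `Ψ`. -/
def SeparableRealization.μ {dstar : UX2 ω X → ProbabilityMeasure I}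
    (R : SeparableRealization dstar) : ProbabilityMeasure I :=
  ⟨(volume : Measure (UX ω X)).map R.Ψ,
    Measure.isProbabilityMeasure_map R.measurable_Ψ.aemeasurable⟩

end Realization

end UltraMM

end

noncomputable section

namespace UltraMM

/-! ### Liftings of functions on the ultraproduct and convergence of their integrals -/

section Lifting

variable {ω : Ultrafilter ℕ} {Y : ℕ → Type*} [∀ n, MeasureSpace (Y n)] [Nonprincipal ω]
  [∀ n, IsProbabilityMeasure (volume : Measure (Y n))]

/-! The distances of `X n` do not converge to `dstar` in any strong sense: conditioning on the
product algebra discards the part of the ultralimit distance that no function of single points can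
see. What survives is convergence in cut norm, that is, when tested against products `f(x) g(y)`,
and this is exactly what sampling detects.

By Stone-Weierstrass on the compact space of matrices (`tendsto_of_forall_integral_prod`), it
suffices to follow integrals of finite products of functions `G q` of the entries. For `X n` the
factors are `G q` of the distance. For the realization, independence of the entries turns them into
the pairings of `d` with `G q`.

To compare the two sides, the realization is moved to the Cantor space by a Borel isomorphism. A
measurable map from the ultraproduct to the Cantor space lifts to measurable maps `Φn` on the `X n`
(`exists_isLifting_cantor`), because each bit is an internal set up to a null set. Each pairing of
the realized distance with `G q` is approximated in `L¹` by a continuous function `w q`. Then `G q`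
of the distance is close in cut norm to `w q` composed with `Φn`, for almost all `n`
(`eventually_cut_le`): otherwise the ultralimits of bad test functions would contradict the defining
identity of the derivative. The counting lemma `abs_integral_prod_sub_le` replaces every factor by
its continuous approximation on both sides. The remaining integrals converge because the laws of
`Φn`, hence their infinite powers, converge weakly (`tendsto_integral_infinitePi`).

Symmetry passes to the limit through integrals against continuous functions of two points, and these
determine the kernel almost everywhere (`ae_symm_of_isLifting`). The random triangle inequality
follows from sampling convergence: a continuous measure of violation of the triangle inequalities
has integral zero for every `X n`, hence in the limit (`randomTriangle_of_tendsto`). For the last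
claim, `d` is redefined below and on the diagonal. -/

theorem measurableSet_internalSet {A : ∀ n, Set (Y n)} (hA : ∀ n, MeasurableSet (A n)) :
    MeasurableSet (internalSet ω A) :=
  ⟨A, hA, by rw [symmDiff_self]; exact isNull_empty⟩

theorem volume_internalSet {A : ∀ n, Set (Y n)} (hA : ∀ n, MeasurableSet (A n)) :
    volume (internalSet ω A) = limMeasure ω A :=
  volume_eq_limMeasure hA (by rw [symmDiff_self]; exact isNull_empty)

theorem tendsto_measureReal_internalSet {A : ∀ n, Set (Y n)} (hA : ∀ n, MeasurableSet (A n)) :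
    Tendsto (fun n => (volume : Measure (Y n)).real (A n)) ω
      (𝓝 ((volume : Measure (UltraProduct ω Y)).real (internalSet ω A))) := by
  rw [Measure.real, volume_internalSet hA]
  refine (ENNReal.tendsto_toReal ?_).comp (tendsto_limMeasure A)
  rw [← volume_internalSet hA]
  exact measure_ne_top _ _

theorem IsNull.volume_eq_zero {N : Set (UltraProduct ω Y)} (h : IsNull ω N) : volume N = 0 := by
  rw [volume_eq_limMeasure (P := fun n => (∅ : Set (Y n))) (fun _ => .empty)
    (by rwa [internalSet_empty, show N ∆ ∅ = N from symmDiff_bot N]), limMeasure_empty]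

theorem exists_internalSet_ae_eq {M : Set (UltraProduct ω Y)} (hM : MeasurableSet M) :
    ∃ P : ∀ n, Set (Y n), (∀ n, MeasurableSet (P n)) ∧ M =ᵐ[volume] internalSet ω P := by
  obtain ⟨P, hP, h⟩ := hM
  exact ⟨P, hP, measure_symmDiff_eq_zero_iff.1 h.volume_eq_zero⟩

/-- A sequence of functions lifts a function on the ultraproduct if its pointwise ultralimit is
almost everywhere equal to that function. -/
def IsLifting {Z : Type*} [TopologicalSpace Z] (F : ∀ n, Y n → Z) (f : UltraProduct ω Y → Z) :
    Prop :=
  ∀ᵐ p, ∀ y, UltraProduct.mk ω y = p → Tendsto (fun n => F n (y n)) ω (𝓝 (f p))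

theorem IsLifting.comp_continuous {Z W : Type*} [TopologicalSpace Z] [TopologicalSpace W]
    {F : ∀ n, Y n → Z} {f : UltraProduct ω Y → Z} (h : IsLifting F f) {g : Z → W}
    (hg : Continuous g) : IsLifting (fun n y => g (F n y)) fun p => g (f p) :=
  Eventually.mono h fun _ hp y hy => (hg.tendsto _).comp (hp y hy)

theorem IsLifting.prodMk {Z W : Type*} [TopologicalSpace Z] [TopologicalSpace W]
    {F : ∀ n, Y n → Z} {f : UltraProduct ω Y → Z} {G : ∀ n, Y n → W} {g : UltraProduct ω Y → W}
    (hF : IsLifting F f) (hG : IsLifting G g) :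
    IsLifting (fun n y => (F n y, G n y)) fun p => (f p, g p) := by
  filter_upwards [hF, hG] with p h1 h2 y hy using (h1 y hy).prodMk_nhds (h2 y hy)

theorem IsLifting.mul {F G : ∀ n, Y n → ℝ} {f g : UltraProduct ω Y → ℝ}
    (hF : IsLifting F f) (hG : IsLifting G g) :
    IsLifting (fun n y => F n y * G n y) fun p => f p * g p := by
  filter_upwards [hF, hG] with p h1 h2 y hy using (h1 y hy).mul (h2 y hy)

theorem IsLifting.sub {F G : ∀ n, Y n → ℝ} {f g : UltraProduct ω Y → ℝ}
    (hF : IsLifting F f) (hG : IsLifting G g) :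
    IsLifting (fun n y => F n y - G n y) fun p => f p - g p := by
  filter_upwards [hF, hG] with p h1 h2 y hy using (h1 y hy).sub (h2 y hy)

/-- Every bounded sequence of real functions lifts its pointwise ultralimit. -/
theorem exists_isLifting {F : ∀ n, Y n → ℝ} {C : ℝ} (hC : ∀ (n : ℕ) (y : Y n), |F n y| ≤ C) :
    ∃ f : UltraProduct ω Y → ℝ, (∀ p, |f p| ≤ C) ∧ IsLifting F f := by
  have key : ∀ y : ∀ n, Y n, ∃ c ∈ Icc (-C) C, Tendsto (fun n => F n (y n)) ω (𝓝 c) := fun y => by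
    have : Filter.map (fun n : ℕ => F n (y n)) ω ≤ 𝓟 (Icc (-C) C) :=
      tendsto_principal.2 (Eventually.of_forall fun n => abs_le.1 (hC n (y n)))
    exact isCompact_Icc.ultrafilter_le_nhds (ω.map fun n => F n (y n)) this
  choose c hc hlim using key
  -- The limit is computed on a chosen representative; any other one agrees with it along `ω` and
  -- has the same limit.
  choose r hr using UltraProduct.exists_mk (ω := ω) (Y := Y)
  refine ⟨fun p => c (r p), fun p => abs_le.2 (hc _), Eventually.of_forall fun p y hy => ?_⟩
  refine (hlim (r p)).congr' ?_
  have h : ∀ᶠ n in (ω : Filter ℕ), r p n = y n := Quotient.exact ((hr p).trans hy.symm)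
  exact h.mono fun n hn => by simp only [hn]

/-- The sum counts the positive multiples of `1/N` up to `t`, so it equals `⌊N * t⌋₊`, and the
average is `t` rounded down to a multiple of `1/N`. This discretizes a function by its superlevel
sets. -/
theorem abs_sub_sum_ite_le {t : ℝ} (h0 : 0 ≤ t) (h1 : t ≤ 1) {N : ℕ} (hN : 0 < N) :
    |t - (N : ℝ)⁻¹ * ∑ k ∈ Finset.range N, if ((k : ℝ) + 1) / N ≤ t then (1 : ℝ) else 0|
      ≤ (N : ℝ)⁻¹ := by
  have hN' : (0 : ℝ) < N := Nat.cast_pos.2 hN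
  have hNt : 0 ≤ N * t := by positivity
  have hle : ⌊N * t⌋₊ ≤ N := Nat.floor_le_of_le (by nlinarith)
  have : (∑ k ∈ Finset.range N, if ((k : ℝ) + 1) / N ≤ t then (1 : ℝ) else 0) = ⌊N * t⌋₊ := by
    rw [Finset.sum_ite, Finset.sum_const_zero, add_zero, Finset.sum_const, nsmul_one]
    congr 1
    convert! Finset.card_range _
    ext k
    have : ((k : ℝ) + 1) / N ≤ t ↔ k + 1 ≤ ⌊N * t⌋₊ := by
      rw [Nat.le_floor_iff hNt, div_le_iff₀ hN', mul_comm t]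
      push_cast
      rfl
    simp only [Finset.mem_filter, Finset.mem_range, this]
    omega
  rw [this]
  have h2 := Nat.floor_le hNt
  have h3 := Nat.lt_floor_add_one (N * t)
  have h4 : t - (N : ℝ)⁻¹ * ⌊N * t⌋₊ = (N : ℝ)⁻¹ * (N * t - ⌊N * t⌋₊) := by
    field_simp
  rw [h4, abs_of_nonneg (by have : 0 ≤ N * t - ⌊N * t⌋₊ := by linarith
                            positivity)]
  exact mul_le_of_le_one_right (by positivity) (by linarith)

theorem integral_sum_ite {Ω : Type*} [MeasurableSpace Ω] (P : Measure Ω) [IsProbabilityMeasure P]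
    (c : ℝ) (s : Finset ℕ) {E : ℕ → Set Ω} (hE : ∀ k, MeasurableSet (E k))
    [∀ k, DecidablePred (· ∈ E k)] :
    Integrable (fun x => c * ∑ k ∈ s, if x ∈ E k then (1 : ℝ) else 0) P ∧
    ∫ x, c * ∑ k ∈ s, (if x ∈ E k then (1 : ℝ) else 0) ∂P = c * ∑ k ∈ s, P.real (E k) := by
  have h : ∀ k, (fun x => if x ∈ E k then (1 : ℝ) else 0) = (E k).indicator fun _ => (1 : ℝ) :=
    fun k => by ext x; simp [Set.indicator_apply]
  have hi : ∀ k, Integrable (fun x => if x ∈ E k then (1 : ℝ) else 0) P := fun k => by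
    rw [h k]
    exact (integrable_const _).indicator (hE k)
  refine ⟨(integrable_finsetSum _ fun k _ => hi k).const_mul _, ?_⟩
  rw [integral_const_mul, integral_finsetSum _ fun k _ => hi k]
  congr 1
  refine Finset.sum_congr rfl fun k _ => ?_
  rw [h k]
  exact integral_indicator_one (hE k)

theorem abs_integral_sub_le_of_ae {Ω : Type*} [MeasurableSpace Ω] {P : Measure Ω}
    [IsProbabilityMeasure P] {f g : Ω → ℝ} (hf : Integrable f P) (hg : Integrable g P) {c : ℝ}
    (h : ∀ᵐ x ∂P, |f x - g x| ≤ c) : |∫ x, f x ∂P - ∫ x, g x ∂P| ≤ c := by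
  rw [← integral_sub hf hg]
  simpa using norm_integral_le_of_norm_le_const (μ := P) (f := fun x => f x - g x) (C := c) h

/-- The usual `ε`-argument, with approximants allowed to depend on `ε`. It serves for step
functions, for Stone-Weierstrass and for the sampling integrals. -/
theorem tendsto_of_forall_approx {ι : Type*} {l : Filter ι} {a : ι → ℝ} {b : ℝ}
    (h : ∀ ε > 0, ∃ (a' : ι → ℝ) (b' : ℝ), Tendsto a' l (𝓝 b') ∧ (∀ᶠ i in l, |a i - a' i| ≤ ε) ∧
      |b - b'| ≤ ε) : Tendsto a l (𝓝 b) := by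
  refine Metric.tendsto_nhds.2 fun ε hε => ?_
  obtain ⟨a', b', ht, ha, hb⟩ := h (ε / 4) (by linarith)
  filter_upwards [ha, Metric.tendsto_nhds.1 ht (ε / 4) (by linarith)] with i h1 h2
  rw [Real.dist_eq] at *
  have h3 := abs_sub_le (a i) (a' i) b
  have h4 := abs_sub_le (a' i) b' b
  rw [abs_sub_comm b' b] at h4
  linarith

/-- Measures of internal sets converge by construction, so integrals of step functions over the
superlevel sets of `F n` converge. Rounding to multiples of `1/N` costs at most `1/N`, uniformly in
`n` and almost everywhere in the limit. -/
theorem IsLifting.aemeasurable_and_tendsto_integral_of_mem_Icc {F : ∀ n, Y n → ℝ}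
    {f : UltraProduct ω Y → ℝ} (h : IsLifting F f) (hm : ∀ n, Measurable (F n))
    (h01 : ∀ n y, F n y ∈ Icc (0 : ℝ) 1) :
    AEMeasurable f ∧ Tendsto (fun n => ∫ y, F n y) ω (𝓝 (∫ p, f p)) := by
  classical
  set E : ℕ → ℕ → ∀ n, Set (Y n) := fun N k n => {y | ((k : ℝ) + 1) / N ≤ F n y} with hE
  have hEm : ∀ N k n, MeasurableSet (E N k n) := fun N k n =>
    measurableSet_le measurable_const (hm n)
  set S : ℕ → UltraProduct ω Y → ℝ := fun N p =>
    (N : ℝ)⁻¹ * ∑ k ∈ Finset.range N, if p ∈ internalSet ω (E N k) then (1 : ℝ) else 0 with hS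
  have hSm : ∀ N, Measurable (S N) := fun N => by
    refine (Finset.measurable_sum _ fun k _ => ?_).const_mul _
    exact Measurable.ite (measurableSet_internalSet (hEm N k)) measurable_const measurable_const
  have happ : ∀ᵐ p, ∀ N : ℕ, 0 < N → |f p - S N p| ≤ (N : ℝ)⁻¹ := by
    filter_upwards [h] with p hp N hN
    obtain ⟨y, rfl⟩ := p.exists_mk
    -- The ultrafilter decides each of the finitely many memberships, so the step function of `F n`
    -- at `y n` is eventually constant and equal to `S N`. Superlevel sets of `f` itself would not
    -- do: they differ from the internal sets when a limit hits a threshold.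
    have hev : ∀ᶠ n in (ω : Filter ℕ), ∀ k ∈ Finset.range N,
        (y n ∈ E N k n ↔ UltraProduct.mk ω y ∈ internalSet ω (E N k)) := by
      refine (Filter.eventually_all_finset _).2 fun k _ => ?_
      by_cases hk : UltraProduct.mk ω y ∈ internalSet ω (E N k)
      · filter_upwards [(mk_mem_internalSet _ _).1 hk] with n hn using iff_of_true hn hk
      · filter_upwards [Ultrafilter.eventually_not.2 ((mk_mem_internalSet _ _).not.1 hk)]
          with n hn using iff_of_false hn hk
    refine le_of_tendsto (((hp y rfl).sub_const _).abs) (hev.mono fun n hn => ?_)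
    have := abs_sub_sum_ite_le (h01 n (y n)).1 (h01 n (y n)).2 hN
    convert! this using 4
    exact Finset.sum_congr rfl fun k hk => if_congr (hn k hk).symm rfl rfl
  have hfm : AEMeasurable f := by
    refine aemeasurable_of_tendsto_metrizable_ae atTop (f := fun N : ℕ => S (N + 1))
      (fun N => (hSm _).aemeasurable) ?_
    filter_upwards [happ] with p hp
    rw [tendsto_iff_dist_tendsto_zero]
    refine squeeze_zero (fun _ => dist_nonneg) (fun N => ?_)
      (tendsto_one_div_add_atTop_nhds_zero_nat (𝕜 := ℝ))
    have := hp (N + 1) N.succ_pos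
    rw [dist_comm, Real.dist_eq, one_div]
    exact_mod_cast this
  have hfi : Integrable f := by
    refine Integrable.of_bound hfm.aestronglyMeasurable 1 ?_
    filter_upwards [h] with p hp
    obtain ⟨y, rfl⟩ := p.exists_mk
    exact le_of_tendsto (hp y rfl).norm (Eventually.of_forall fun n => by
      rw [Real.norm_of_nonneg (h01 n (y n)).1]; exact (h01 n (y n)).2)
  refine ⟨hfm, tendsto_of_forall_approx fun ε hε => ?_⟩
  obtain ⟨N, hN0, hN⟩ : ∃ N : ℕ, 0 < N ∧ (N : ℝ)⁻¹ ≤ ε := by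
    obtain ⟨N, hN⟩ := exists_nat_one_div_lt hε
    exact ⟨N + 1, N.succ_pos, by rw [one_div] at hN; exact_mod_cast hN.le⟩
  refine ⟨fun n => (N : ℝ)⁻¹ * ∑ k ∈ Finset.range N, (volume : Measure (Y n)).real (E N k n),
    (N : ℝ)⁻¹ * ∑ k ∈ Finset.range N, volume.real (internalSet ω (E N k)), ?_, ?_, ?_⟩
  · exact (tendsto_finsetSum _ fun k _ => tendsto_measureReal_internalSet (hEm N k)).const_mul _
  · refine Eventually.of_forall fun n => ?_
    obtain ⟨hi, he⟩ := integral_sum_ite (volume : Measure (Y n)) (N : ℝ)⁻¹ (Finset.range N)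
      (fun k => hEm N k n)
    beta_reduce
    rw [← he]
    refine abs_integral_sub_le_of_ae ?_ hi (Eventually.of_forall fun y => ?_)
    · exact Integrable.of_bound (hm n).aestronglyMeasurable 1 (Eventually.of_forall fun y => by
        rw [Real.norm_of_nonneg (h01 n y).1]; exact (h01 n y).2)
    · exact (abs_sub_sum_ite_le (h01 n y).1 (h01 n y).2 hN0).trans hN
  · obtain ⟨hi, he⟩ := integral_sum_ite (volume : Measure (UltraProduct ω Y)) (N : ℝ)⁻¹
      (Finset.range N) (fun k => measurableSet_internalSet (hEm N k))
    rw [← he]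
    exact abs_integral_sub_le_of_ae hfi hi (happ.mono fun p hp => (hp N hN0).trans hN)

theorem IsLifting.ae_abs_le {F : ∀ n, Y n → ℝ} {f : UltraProduct ω Y → ℝ} (h : IsLifting F f)
    {C : ℝ} (hC : ∀ n y, |F n y| ≤ C) : ∀ᵐ p, |f p| ≤ C := by
  filter_upwards [h] with p hp
  obtain ⟨y, rfl⟩ := p.exists_mk
  exact le_of_tendsto (hp y rfl).abs (Eventually.of_forall fun n => hC n (y n))

/-- The case of values in `[0,1]` is transported by the affine map `t ↦ (t / D + 1) / 2` and its
inverse. The bound `C` is first enlarged to a positive `D`, so that division makes sense. -/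
theorem IsLifting.aemeasurable_and_tendsto_integral {F : ∀ n, Y n → ℝ}
    {f : UltraProduct ω Y → ℝ} (h : IsLifting F f) (hm : ∀ n, Measurable (F n)) {C : ℝ}
    (hC : ∀ n y, |F n y| ≤ C) :
    AEMeasurable f ∧ Tendsto (fun n => ∫ y, F n y) ω (𝓝 (∫ p, f p)) := by
  have : ∃ D : ℝ, 0 < D ∧ ∀ n y, |F n y| ≤ D :=
    ⟨max C 1, by positivity, fun n y => (hC n y).trans (le_max_left _ _)⟩
  obtain ⟨D, hD, hFD⟩ := this
  have hg : Continuous fun t : ℝ => (t / D + 1) / 2 := by fun_prop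
  obtain ⟨h1, h2⟩ := (h.comp_continuous hg).aemeasurable_and_tendsto_integral_of_mem_Icc
    (fun n => hg.measurable.comp (hm n)) (fun n y => by
      have := abs_le.1 (hFD n y)
      have h3 : F n y / D ≤ 1 := (div_le_one hD).2 this.2
      have h4 : -1 ≤ F n y / D := by rw [le_div_iff₀ hD]; linarith [this.1]
      constructor <;> linarith)
  have hinv : ∀ t : ℝ, t = (2 * ((t / D + 1) / 2) - 1) * D := fun t => by field_simp; ring
  have hfm : AEMeasurable f := by
    have := (((h1.const_mul 2).sub_const 1).mul_const D)
    refine this.congr (Eventually.of_forall fun p => (hinv (f p)).symm)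
  refine ⟨hfm, ?_⟩
  have e : ∀ {Ω : Type _} [MeasurableSpace Ω] (P : Measure Ω) [IsProbabilityMeasure P] (g : Ω → ℝ),
      Integrable g P → ∫ x, (g x / D + 1) / 2 ∂P = ((∫ x, g x ∂P) / D + 1) / 2 :=
    fun P _ g hgi => by
      rw [integral_div, integral_add (hgi.div_const D) (integrable_const _), integral_div]
      simp
  have hfi : Integrable f :=
    Integrable.of_bound hfm.aestronglyMeasurable C (h.ae_abs_le hC)
  have hFi : ∀ n, Integrable (F n) := fun n =>
    Integrable.of_bound (hm n).aestronglyMeasurable C (Eventually.of_forall (hC n))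
  rw [e _ f hfi] at h2
  have := ((h2.const_mul 2).sub_const 1).mul_const D
  rw [← hinv] at this
  refine this.congr fun n => ?_
  rw [e _ _ (hFi n), ← hinv]

/-- Countability is needed to unite the exceptional null sets of the coordinates. -/
theorem isLifting_pi {ι : Type*} [Countable ι] {Z : ι → Type*} [∀ i, TopologicalSpace (Z i)]
    {F : ∀ n, Y n → ∀ i, Z i} {f : UltraProduct ω Y → ∀ i, Z i}
    (h : ∀ i, IsLifting (fun n y => F n y i) fun p => f p i) : IsLifting F f := by
  have := ae_all_iff.2 h
  filter_upwards [this] with p hp y hy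
  exact tendsto_pi_nhds.2 fun i => hp i y hy

/-- Measurable maps to the Cantor space have measurable liftings. -/
theorem exists_isLifting_cantor {f : UltraProduct ω Y → ℕ → Bool} (hf : Measurable f) :
    ∃ F : ∀ n, Y n → ℕ → Bool, (∀ n, Measurable (F n)) ∧ IsLifting F f := by
  classical
  -- Each bit is the indicator of a measurable set, hence of an internal set up to a null set. As
  -- bits are discrete, the lifted bits converge by being eventually equal to the limit.
  have hM : ∀ k, MeasurableSet {p | f p k = true} := fun k =>
    ((measurable_pi_apply k).comp hf) (measurableSet_singleton true)
  choose P hP hMP using fun k => exists_internalSet_ae_eq (hM k)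
  refine ⟨fun n y k => decide (y ∈ P k n), fun n => measurable_pi_lambda _ fun k => ?_,
    isLifting_pi fun k => ?_⟩
  · refine measurable_to_bool ?_
    convert! hP k n using 1
    ext y
    simp
  · filter_upwards [(hMP k).mem_iff] with p hp y hy
    subst hy
    rw [mk_mem_internalSet] at hp
    refine tendsto_nhds_of_eventually_eq ?_
    by_cases hk : f (UltraProduct.mk ω y) k = true
    · filter_upwards [hp.1 hk] with n hn
      simp [hn, hk]
    · filter_upwards [Ultrafilter.eventually_not.2 (mt hp.2 hk)] with n hn
      simp [hn, hk]

end Lifting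

/-! ### Test functions for weak convergence on compact spaces -/

section WeakConvergence

/-- On a compact space, weak convergence may be tested on a point-separating multiplicative set of
continuous functions. -/
theorem tendsto_of_forall_mem_submonoid {E ι : Type*} [TopologicalSpace E] [CompactSpace E]
    [MeasurableSpace E] [OpensMeasurableSpace E] {l : Filter ι} {P : ι → ProbabilityMeasure E}
    {Q : ProbabilityMeasure E} (S : Submonoid C(E, ℝ))
    (hsep : ∀ x y, x ≠ y → ∃ f ∈ S, f x ≠ f y)
    (h : ∀ f ∈ S, Tendsto (fun i => ∫ x, f x ∂(P i : Measure E)) l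
      (𝓝 (∫ x, f x ∂(Q : Measure E)))) :
    Tendsto P l (𝓝 Q) := by
  have hint : ∀ (f : C(E, ℝ)) (R : ProbabilityMeasure E), Integrable f (R : Measure E) :=
    fun f R => (BoundedContinuousFunction.mkOfCompact f).integrable _
  have hA : (Algebra.adjoin ℝ (S : Set C(E, ℝ))).SeparatesPoints := fun x y hxy => by
    obtain ⟨f, hf, hne⟩ := hsep x y hxy
    exact ⟨f, ⟨f, Algebra.subset_adjoin hf, rfl⟩, hne⟩
  have hspan : ∀ f ∈ Algebra.adjoin ℝ (S : Set C(E, ℝ)),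
      Tendsto (fun i => ∫ x, f x ∂(P i : Measure E)) l (𝓝 (∫ x, f x ∂(Q : Measure E))) := by
    intro f hf
    -- Since `S` is closed under products, the algebra it generates is its linear span, and
    -- linearity of the integral is enough.
    rw [← Subalgebra.mem_toSubmodule, Algebra.adjoin_eq_span, Submonoid.closure_eq] at hf
    induction hf using Submodule.span_induction with
    | mem f hf => exact h f hf
    | zero => simpa using tendsto_const_nhds
    | add f g _ _ hf hg =>
      simp only [ContinuousMap.add_apply]
      rw [integral_add (hint f Q) (hint g Q)]
      exact (hf.add hg).congr fun i => (integral_add (hint f _) (hint g _)).symm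
    | smul c f _ hf =>
      simp only [ContinuousMap.smul_apply, integral_smul]
      exact hf.const_smul c
  refine ProbabilityMeasure.tendsto_iff_forall_integral_tendsto.2 fun f => ?_
  refine tendsto_of_forall_approx fun ε hε => ?_
  have hmem := ContinuousMap.continuousMap_mem_subalgebra_closure_of_separatesPoints _ hA
    f.toContinuousMap
  obtain ⟨g, hg, hdist⟩ := Metric.mem_closure_iff.1 hmem ε hε
  have hfg : ∀ x, |f x - g x| ≤ ε := fun x =>
    (ContinuousMap.dist_apply_le_dist (f := f.toContinuousMap) (g := g) x).trans hdist.le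
  exact ⟨_, _, hspan g hg, Eventually.of_forall fun i =>
    abs_integral_sub_le_of_ae (f.integrable _) (hint g _) (Eventually.of_forall hfg),
    abs_integral_sub_le_of_ae (f.integrable _) (hint g _) (Eventually.of_forall hfg)⟩

/-- On a compact space with a separating family of continuous coordinates in a compact Hausdorff
space, weak convergence may be tested on finite products of bounded functions of coordinates. -/
theorem tendsto_of_forall_integral_prod {E Z ι κ : Type*} [TopologicalSpace E] [CompactSpace E]
    [MeasurableSpace E] [OpensMeasurableSpace E] [TopologicalSpace Z] [CompactSpace Z] [T2Space Z]
    {l : Filter ι} {P : ι → ProbabilityMeasure E} {Q : ProbabilityMeasure E} (π : κ → C(E, Z))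
    (hπ : ∀ x y, (∀ k, π k x = π k y) → x = y)
    (h : ∀ (s : Finset κ) (f : κ → C(Z, ℝ)), (∀ k z, |f k z| ≤ 1) →
      Tendsto (fun i => ∫ x, ∏ k ∈ s, f k (π k x) ∂(P i : Measure E)) l
        (𝓝 (∫ x, ∏ k ∈ s, f k (π k x) ∂(Q : Measure E)))) :
    Tendsto P l (𝓝 Q) := by
  classical
  -- Requiring `f k = 1` off `s` lets two products over different index sets both be rewritten over
  -- the union and multiplied factor by factor.
  let S : Submonoid C(E, ℝ) :=
    { carrier := {F | ∃ (s : Finset κ) (f : κ → C(Z, ℝ)), (∀ k z, |f k z| ≤ 1) ∧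
        (∀ k, k ∉ s → f k = 1) ∧ ∀ x, F x = ∏ k ∈ s, f k (π k x)}
      one_mem' := ⟨∅, fun _ => 1, by simp, by simp, by simp⟩
      mul_mem' := by
        rintro F G ⟨s, f, hf, hfs, hF⟩ ⟨t, g, hg, hgt, hG⟩
        refine ⟨s ∪ t, fun k => f k * g k, fun k z => ?_, fun k hk => ?_, fun x => ?_⟩
        · rw [ContinuousMap.mul_apply, abs_mul]
          exact mul_le_one₀ (hf k z) (abs_nonneg _) (hg k z)
        · rw [Finset.mem_union, not_or] at hk
          simp only [hfs k hk.1, hgt k hk.2, one_mul]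
        · rw [ContinuousMap.mul_apply, hF, hG]
          simp only [ContinuousMap.mul_apply, Finset.prod_mul_distrib]
          congr 1
          · exact Finset.prod_subset Finset.subset_union_left fun k _ hk => by simp [hfs k hk]
          · exact Finset.prod_subset Finset.subset_union_right fun k _ hk => by simp [hgt k hk] }
  refine tendsto_of_forall_mem_submonoid S (fun x y hxy => ?_) ?_
  · obtain ⟨k, hk⟩ : ∃ k, π k x ≠ π k y := by
      by_contra! hcon
      exact hxy (hπ x y hcon)
    obtain ⟨f, h0, h1, h01⟩ := exists_continuous_zero_one_of_isClosed
      (isClosed_singleton (x := π k x)) (isClosed_singleton (x := π k y))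
      (disjoint_singleton.2 hk)
    refine ⟨f.comp (π k), ⟨{k}, fun j => if j = k then f else 1, fun j z => ?_, fun j hj => ?_,
      fun x => by simp⟩, ?_⟩
    · by_cases hj : j = k
      · simp only [if_pos hj]
        rw [abs_of_nonneg (h01 z).1]
        exact (h01 z).2
      · simp [hj]
    · simp [Finset.mem_singleton.not.1 hj]
    · rw [ContinuousMap.comp_apply, ContinuousMap.comp_apply, h0 rfl, h1 rfl]
      simp
  · rintro F ⟨s, f, hf, -, hF⟩
    simp only [hF]
    exact h s f hf

end WeakConvergence

/-! ### Infinite powers of a measure and the counting lemma -/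

section InfinitePi

open ProbabilityTheory

theorem integral_finset_prod_infinitePi {ι Ω : Type*} [MeasurableSpace Ω] (μ : ι → Measure Ω)
    [∀ i, IsProbabilityMeasure (μ i)] (s : Finset ι) {f : ι → Ω → ℝ}
    (hf : ∀ i, Measurable (f i)) :
    ∫ x, ∏ i ∈ s, f i (x i) ∂Measure.infinitePi μ = ∏ i ∈ s, ∫ t, f i t ∂μ i := by
  have h1 : ∀ x : ι → Ω, ∏ i ∈ s, f i (x i) = ∏ i : s, f i (s.restrict x i) := fun x => by
    rw [← Finset.prod_coe_sort]
    rfl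
  simp only [h1]
  have hm : Measurable fun y : s → Ω => ∏ i : s, f i (y i) :=
    Finset.measurable_prod _ fun i _ => (hf i).comp (measurable_pi_apply i)
  refine (integral_restrict_infinitePi (μ := μ) hm.aestronglyMeasurable).trans ?_
  rw [integral_fintype_prod_eq_prod (fun (i : s) (t : Ω) => f i t)]
  exact Finset.prod_coe_sort s fun i => ∫ t, f i t ∂μ i

/-- Weak convergence of probability measures on a compact space implies weak convergence of their
infinite powers. -/
theorem tendsto_integral_infinitePi {K ι : Type*} [TopologicalSpace K] [CompactSpace K] [T2Space K]
    [SecondCountableTopology K] [MeasurableSpace K] [OpensMeasurableSpace K] {l : Filter ι}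
    {P : ι → ProbabilityMeasure K} {Q : ProbabilityMeasure K}
    (h : ∀ f : C(K, ℝ), Tendsto (fun i => ∫ x, f x ∂(P i : Measure K)) l
      (𝓝 (∫ x, f x ∂(Q : Measure K)))) (F : C(ℕ → K, ℝ)) :
    Tendsto (fun i => ∫ x, F x ∂Measure.infinitePi fun _ : ℕ => (P i : Measure K)) l
      (𝓝 (∫ x, F x ∂Measure.infinitePi fun _ : ℕ => (Q : Measure K))) := by
  let pow : ProbabilityMeasure K → ProbabilityMeasure (ℕ → K) := fun R =>
    ⟨Measure.infinitePi fun _ => (R : Measure K), inferInstance⟩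
  have key : Tendsto (fun i => pow (P i)) l (𝓝 (pow Q)) := by
    refine tendsto_of_forall_integral_prod
      (fun k : ℕ => (⟨fun x => x k, continuous_apply k⟩ : C(ℕ → K, K))) (fun x y => funext) ?_
    intro s f _
    simp only [pow, ProbabilityMeasure.coe_mk, ContinuousMap.coe_mk]
    rw [integral_finset_prod_infinitePi _ s fun i => (f i).continuous.measurable]
    refine Tendsto.congr (fun i => (integral_finset_prod_infinitePi _ s
      fun i => (f i).continuous.measurable).symm) ?_
    exact tendsto_finsetProd _ fun i _ => h (f i)
  exact ProbabilityMeasure.tendsto_iff_forall_integral_tendsto.1 key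
    (BoundedContinuousFunction.mkOfCompact F)

variable {Ω : Type*} [MeasurableSpace Ω]

theorem measurable_update_pair (i : ℕ) :
    Measurable fun p : (ℕ → Ω) × Ω => Function.update p.1 i p.2 := by
  refine measurable_pi_lambda _ fun k => ?_
  by_cases h : k = i
  · subst h
    simpa using measurable_snd
  · simp only [Function.update_of_ne h]
    exact (measurable_pi_apply k).comp measurable_fst

/-- Resampling one coordinate preserves the infinite power of a probability measure. -/
theorem measurePreserving_update (μ : Measure Ω) [IsProbabilityMeasure μ] (i : ℕ) :
    MeasurePreserving (fun p : (ℕ → Ω) × Ω => Function.update p.1 i p.2)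
      ((Measure.infinitePi fun _ => μ).prod μ) (Measure.infinitePi fun _ => μ) := by
  classical
  refine ⟨measurable_update_pair i, Measure.eq_infinitePi _ fun s t ht => ?_⟩
  rw [Measure.map_apply (measurable_update_pair i) (.pi s.countable_toSet fun _ _ => ht _)]
  have : (fun p : (ℕ → Ω) × Ω => Function.update p.1 i p.2) ⁻¹' ((s : Set ℕ).pi t)
      = (((s.erase i : Finset ℕ) : Set ℕ).pi t) ×ˢ (if i ∈ s then t i else univ) := by
    ext ⟨x, a⟩
    simp only [mem_preimage, Set.mem_pi, Finset.mem_coe, mem_prod, Finset.mem_erase]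
    constructor
    · intro h
      refine ⟨fun k hk => by simpa [hk.1] using h k hk.2, ?_⟩
      split_ifs with hi
      · simpa using h i hi
      · trivial
    · rintro ⟨h1, h2⟩ k hk
      by_cases hki : k = i
      · subst hki
        simpa [hk] using h2
      · simpa [hki] using h1 k ⟨hki, hk⟩
  rw [this, Measure.prod_prod, Measure.infinitePi_pi _ fun i _ => ht i]
  split_ifs with hi
  · rw [mul_comm]
    exact Finset.mul_prod_erase s (fun i => μ (t i)) hi
  · rw [measure_univ, mul_one, Finset.erase_eq_of_notMem hi]

theorem integrable_of_measurable_of_abs_le {P : Measure Ω} [IsFiniteMeasure P] {f : Ω → ℝ}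
    (hf : Measurable f) {C : ℝ} (hC : ∀ x, |f x| ≤ C) : Integrable f P :=
  Integrable.of_bound hf.aestronglyMeasurable C (Eventually.of_forall hC)

theorem abs_integral_le_of_abs_le {P : Measure Ω} [IsProbabilityMeasure P] {f : Ω → ℝ} {C : ℝ}
    (hC : ∀ x, |f x| ≤ C) : |∫ x, f x ∂P| ≤ C := by
  simpa using norm_integral_le_of_norm_le_const (μ := P) (f := f) (C := C)
    (Eventually.of_forall hC)

theorem integral_update (μ : Measure Ω) [IsProbabilityMeasure μ] (i : ℕ) {F : (ℕ → Ω) → ℝ}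
    (hF : Measurable F) {C : ℝ} (hC : ∀ x, |F x| ≤ C) :
    ∫ x, F x ∂Measure.infinitePi (fun _ => μ)
      = ∫ x, ∫ a, F (Function.update x i a) ∂μ ∂Measure.infinitePi (fun _ => μ) := by
  have hm := measurable_update_pair (Ω := Ω) i
  rw [← (measurePreserving_update μ i).map_eq, integral_map hm.aemeasurable
    hF.aestronglyMeasurable, integral_prod (fun p : (ℕ → Ω) × Ω => F (Function.update p.1 i p.2))
    (integrable_of_measurable_of_abs_le (hF.comp hm) fun p => hC _), (measurePreserving_update μ i).map_eq]

/-- Resampling two coordinates isolates an inner integral over `μ.prod μ` with all other points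
frozen, which is where a cut norm bound can be applied. -/
theorem integral_update_update (μ : Measure Ω) [IsProbabilityMeasure μ] (i j : ℕ)
    {F : (ℕ → Ω) → ℝ} (hF : Measurable F) {C : ℝ} (hC : ∀ x, |F x| ≤ C) :
    ∫ x, F x ∂Measure.infinitePi (fun _ => μ)
      = ∫ x, ∫ p : Ω × Ω, F (Function.update (Function.update x i p.1) j p.2) ∂μ.prod μ
          ∂Measure.infinitePi (fun _ => μ) := by
  have hm := measurable_update_pair (Ω := Ω) j
  rw [integral_update μ j hF hC]
  have h1 : Measurable fun x : ℕ → Ω => ∫ b, F (Function.update x j b) ∂μ :=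
    (StronglyMeasurable.integral_prod_right (f := fun x b => F (Function.update x j b))
      (hF.comp hm).stronglyMeasurable).measurable
  rw [integral_update μ i h1 fun x => abs_integral_le_of_abs_le fun b => hC _]
  congr 1
  ext x
  rw [integral_prod _ (integrable_of_measurable_of_abs_le ?_ fun p => hC _)]
  refine hF.comp (hm.comp (Measurable.prodMk ?_ measurable_snd))
  exact ((measurable_update_pair i).comp (measurable_const.prodMk measurable_id)).comp
    measurable_fst

/-- The pair of points of a sequence given by a pair of indices. -/
def pairAt (x : ℕ → Ω) (q : Pairs) : Ω × Ω := (x q.1.1, x q.1.2)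

theorem measurable_pairAt (q : Pairs) : Measurable fun x : ℕ → Ω => pairAt x q :=
  (measurable_pi_apply _).prodMk (measurable_pi_apply _)

theorem abs_prod_le_one {ι : Type*} (s : Finset ι) {f : ι → ℝ} (h : ∀ i ∈ s, |f i| ≤ 1) :
    |∏ i ∈ s, f i| ≤ 1 := by
  rw [Finset.abs_prod]
  exact Finset.prod_le_one (fun _ _ => abs_nonneg _) h

/-- A function of one pair of points that is small in cut norm stays small when it is multiplied
with bounded functions of other pairs. -/
theorem abs_integral_mul_prod_le (μ : Measure Ω) [IsProbabilityMeasure μ] {W : Ω × Ω → ℝ}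
    (hW : Measurable W) {C : ℝ} (hWC : ∀ z, |W z| ≤ C) {δ : ℝ}
    (hcut : ∀ f g : Ω → ℝ, Measurable f → Measurable g → (∀ a, |f a| ≤ 1) → (∀ a, |g a| ≤ 1) →
      |∫ z, W z * (f z.1 * g z.2) ∂μ.prod μ| ≤ δ)
    {a : Pairs} {s : Finset Pairs} (ha : a ∉ s) {z : Pairs → Ω × Ω → ℝ}
    (hz : ∀ q, Measurable (z q)) (hz1 : ∀ q ∈ s, ∀ p, |z q p| ≤ 1) :
    |∫ x, W (pairAt x a) * ∏ q ∈ s, z q (pairAt x q) ∂Measure.infinitePi fun _ => μ| ≤ δ := by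
  classical
  obtain ⟨⟨i, j⟩, hij⟩ := a
  simp only at hij
  have hprod : ∀ x : ℕ → Ω, |∏ q ∈ s, z q (pairAt x q)| ≤ 1 := fun x =>
    abs_prod_le_one s fun q hq => hz1 q hq _
  have hpm : Measurable fun x : ℕ → Ω => ∏ q ∈ s, z q (pairAt x q) :=
    Finset.measurable_prod _ fun q _ => (hz q).comp (measurable_pairAt q)
  have hFm : Measurable fun x : ℕ → Ω => W (pairAt x ⟨(i, j), hij⟩) * ∏ q ∈ s, z q (pairAt x q) :=
    (hW.comp (measurable_pairAt _)).mul hpm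
  rw [integral_update_update μ i j hFm (C := C) fun x => by
      rw [abs_mul]
      exact (mul_le_of_le_one_right (abs_nonneg _) (hprod x)).trans (hWC _)]
  refine abs_integral_le_of_abs_le fun x => ?_
  -- With the other points frozen, factors without the index `j` depend on the new `i`-th point at
  -- most, and factors with `j` on the new `j`-th point only. The product is then of the form
  -- `f(p.1) g(p.2)`.
  set s₁ := s.filter fun q => ¬ (q.1.1 = j ∨ q.1.2 = j) with hs₁
  set s₂ := s.filter fun q => q.1.1 = j ∨ q.1.2 = j with hs₂
  have hup : ∀ k, Measurable fun b : Ω => Function.update x k b := fun k =>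
    (measurable_update_pair k).comp (measurable_const.prodMk measurable_id)
  convert! hcut (fun b => ∏ q ∈ s₁, z q (pairAt (Function.update x i b) q))
    (fun b => ∏ q ∈ s₂, z q (pairAt (Function.update x j b) q))
    (Finset.measurable_prod _ fun q _ => (hz q).comp ((measurable_pairAt q).comp (hup i)))
    (Finset.measurable_prod _ fun q _ => (hz q).comp ((measurable_pairAt q).comp (hup j)))
    (fun b => abs_prod_le_one _ fun q hq => hz1 q (Finset.mem_of_mem_filter q hq) _)
    (fun b => abs_prod_le_one _ fun q hq => hz1 q (Finset.mem_of_mem_filter q hq) _)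
    using 3
  ext p
  rw [← Finset.prod_filter_mul_prod_filter_not s fun q => q.1.1 = j ∨ q.1.2 = j, ← hs₁, ← hs₂,
    mul_comm (∏ q ∈ s₂, _)]
  congr 1
  · simp [pairAt, Function.update_of_ne hij.ne]
  congr 1
  · refine Finset.prod_congr rfl fun q hq => ?_
    have hq' := (Finset.mem_filter.1 hq).2
    rw [not_or] at hq'
    simp only [pairAt, Function.update_of_ne hq'.1, Function.update_of_ne hq'.2]
  · refine Finset.prod_congr rfl fun q hq => ?_
    obtain ⟨hqs, hq'⟩ := Finset.mem_filter.1 hq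
    -- A pair containing both `i` and `j` would be `(i, j)` itself, which `ha` excludes; the
    -- reversed order is impossible because pairs are increasing.
    have hne : q.1.1 ≠ i ∧ q.1.2 ≠ i := by
      have hlt := q.2
      refine ⟨fun h => ?_, fun h => ?_⟩
      · rcases hq' with h' | h'
        · omega
        · exact ha (by rwa [show q = ⟨(i, j), hij⟩ from Subtype.ext (Prod.ext h h')] at hqs)
      · rcases hq' with h' | h' <;> omega
    simp only [pairAt, Function.update_apply, if_neg hne.1, if_neg hne.2]

/-- The counting lemma: the integral of a product of bounded functions of pairs depends continuously
on the functions in cut norm. -/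
theorem abs_integral_prod_sub_le (μ : Measure Ω) [IsProbabilityMeasure μ] (s : Finset Pairs)
    {u v : Pairs → Ω × Ω → ℝ} (hu : ∀ q, Measurable (u q)) (hv : ∀ q, Measurable (v q))
    (hu1 : ∀ q z, |u q z| ≤ 1) (hv1 : ∀ q z, |v q z| ≤ 1) {δ : ℝ}
    (hcut : ∀ q ∈ s, ∀ f g : Ω → ℝ, Measurable f → Measurable g → (∀ a, |f a| ≤ 1) →
      (∀ a, |g a| ≤ 1) → |∫ z, (u q z - v q z) * (f z.1 * g z.2) ∂μ.prod μ| ≤ δ) :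
    |∫ x, ∏ q ∈ s, u q (pairAt x q) ∂Measure.infinitePi (fun _ => μ)
      - ∫ x, ∏ q ∈ s, v q (pairAt x q) ∂Measure.infinitePi (fun _ => μ)| ≤ s.card * δ := by
  classical
  -- Hybrid products: enlarging `t` by one pair changes a single factor from `v` to `u`, at a cost
  -- of at most `δ`.
  let mix : Finset Pairs → Pairs → Ω × Ω → ℝ := fun t q => if q ∈ t then u q else v q
  have hmix : ∀ t q, Measurable (mix t q) := fun t q => by
    by_cases h : q ∈ t <;> simp [mix, h, hu, hv]
  have hmix1 : ∀ t q z, |mix t q z| ≤ 1 := fun t q z => by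
    by_cases h : q ∈ t <;> simp [mix, h, hu1, hv1]
  have hint : ∀ t, Integrable (fun x : ℕ → Ω => ∏ q ∈ s, mix t q (pairAt x q))
      (Measure.infinitePi fun _ => μ) := fun t =>
    integrable_of_measurable_of_abs_le
      (Finset.measurable_prod _ fun q _ => (hmix t q).comp (measurable_pairAt q))
      fun x => abs_prod_le_one s fun q _ => hmix1 t q _
  have key : ∀ t ⊆ s, |∫ x, ∏ q ∈ s, mix t q (pairAt x q) ∂Measure.infinitePi (fun _ => μ)
      - ∫ x, ∏ q ∈ s, v q (pairAt x q) ∂Measure.infinitePi (fun _ => μ)| ≤ t.card * δ := by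
    intro t
    induction t using Finset.induction_on with
    | empty => intro _; simp [mix]
    | insert a t hat ih =>
      intro hts
      have has : a ∈ s := hts (Finset.mem_insert_self a t)
      have h1 := ih ((Finset.subset_insert a t).trans hts)
      have h2 : |∫ x, ∏ q ∈ s, mix (insert a t) q (pairAt x q) ∂Measure.infinitePi (fun _ => μ)
          - ∫ x, ∏ q ∈ s, mix t q (pairAt x q) ∂Measure.infinitePi (fun _ => μ)| ≤ δ := by
        rw [← integral_sub (hint _) (hint _)]
        convert! abs_integral_mul_prod_le μ ((hu a).sub (hv a)) (C := 2) (fun z => ?_)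
          (hcut a has) (Finset.notMem_erase a s) (hmix t) (fun q _ => hmix1 t q) using 3
        · ext x
          rw [← Finset.mul_prod_erase s _ has, ← Finset.mul_prod_erase s (fun q => mix t q _) has]
          have : ∏ q ∈ s.erase a, mix (insert a t) q (pairAt x q)
              = ∏ q ∈ s.erase a, mix t q (pairAt x q) :=
            Finset.prod_congr rfl fun q hq => by
              simp [mix, Finset.ne_of_mem_erase hq]
          rw [this]
          simp only [mix, Finset.mem_insert_self, if_true, hat, if_false, Pi.sub_apply]
          ring
        · have h1 := abs_le.1 (hu1 a z)
          have h2 := abs_le.1 (hv1 a z)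
          simp only [Pi.sub_apply]
          exact abs_le.2 ⟨by linarith, by linarith⟩
      rw [Finset.card_insert_of_notMem hat]
      push_cast
      have h3 := abs_sub_le
        (∫ x, ∏ q ∈ s, mix (insert a t) q (pairAt x q) ∂Measure.infinitePi (fun _ => μ))
        (∫ x, ∏ q ∈ s, mix t q (pairAt x q) ∂Measure.infinitePi (fun _ => μ))
        (∫ x, ∏ q ∈ s, v q (pairAt x q) ∂Measure.infinitePi (fun _ => μ))
      linarith
  convert! key s subset_rfl using 5 with x q hq
  refine Finset.prod_congr rfl fun q hq => ?_
  simp [mix, hq]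

end InfinitePi

/-! ### The derivative as a conditional expectation -/

section Derivative

open ProbabilityTheory

/-- The integral of a continuous function, as a function of a probability measure on `[0,1]`. -/
def pairing (G : C(I, ℝ)) (ν : ProbabilityMeasure I) : ℝ := ∫ t, G t ∂(ν : Measure I)

theorem measurable_pairing (G : C(I, ℝ)) : Measurable (pairing G) := by
  let κ : Kernel (ProbabilityMeasure I) I := ⟨fun ν => (ν : Measure I), measurable_subtype_coe⟩
  exact (StronglyMeasurable.integral_kernel (κ := κ)
    G.continuous.measurable.stronglyMeasurable).measurable

theorem abs_pairing_le {G : C(I, ℝ)} {C : ℝ} (hG : ∀ t, |G t| ≤ C) (ν : ProbabilityMeasure I) :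
    |pairing G ν| ≤ C :=
  abs_integral_le_of_abs_le hG

theorem exists_abs_le (G : C(I, ℝ)) : ∃ C, ∀ t, |G t| ≤ C :=
  ⟨‖G‖, fun t => G.norm_coe_le_norm t⟩

/-- The defining identity of a Radon-Nikodym-Dunford-Pettis derivative extends to integrals against
bounded functions. -/
theorem IsRNDPDerivative.integral_mul_eq {Ω : Type*} {𝓑 : MeasurableSpace Ω} [m₀ : MeasurableSpace Ω]
    {P : Measure Ω} [IsProbabilityMeasure P] (hle : 𝓑 ≤ m₀) {f : Ω → I}
    {F : Ω → ProbabilityMeasure I} (h : IsRNDPDerivative P 𝓑 f F) (hf : AEMeasurable f P)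
    (G : C(I, ℝ)) {k : Ω → ℝ} (hk : Measurable[𝓑] k) {C : ℝ} (hC : ∀ᵐ x ∂P, |k x| ≤ C) :
    ∫ x, k x * G (f x) ∂P = ∫ x, k x * pairing G (F x) ∂P := by
  obtain ⟨D, hD⟩ := exists_abs_le G
  have hFm : Measurable[𝓑] fun x => pairing G (F x) := (measurable_pairing G).comp h.measurable
  have hGm : AEMeasurable (fun x => G (f x)) P := G.continuous.measurable.comp_aemeasurable hf
  have hGi : Integrable (fun x => G (f x)) P :=
    Integrable.of_bound hGm.aestronglyMeasurable D (Eventually.of_forall fun x => hD _)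
  have hFi : Integrable (fun x => pairing G (F x)) P :=
    integrable_of_measurable_of_abs_le (hFm.mono hle le_rfl) fun x => abs_pairing_le hD _
  have hkGi : Integrable (k * fun x => G (f x)) P :=
    hGi.bdd_mul (hk.mono hle le_rfl).aestronglyMeasurable hC
  -- The identity over sets of `𝓑` identifies the pairing with a conditional expectation; the
  -- `𝓑`-measurable factor `k` can then be pulled out.
  have hce : (fun x => pairing G (F x)) =ᵐ[P] P[fun x => G (f x) | 𝓑] :=
    ae_eq_condExp_of_forall_setIntegral_eq hle hGi (fun _ _ _ => hFi.integrableOn)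
      (fun B hB _ => h.setIntegral_eq G B hB) hFm.stronglyMeasurable.aestronglyMeasurable
  have hpull := condExp_mul_of_stronglyMeasurable_left (μ := P) hk.stronglyMeasurable hkGi hGi
  calc ∫ x, k x * G (f x) ∂P = ∫ x, (P[k * fun x => G (f x) | 𝓑]) x ∂P :=
        (integral_condExp hle).symm
    _ = ∫ x, k x * pairing G (F x) ∂P := by
        refine integral_congr_ae ?_
        filter_upwards [hpull, hce] with x h1 h2
        rw [h1, Pi.mul_apply, ← h2]

end Derivative

/-! ### The ultraproduct of squares and its projections -/

section Square

variable {ω : Ultrafilter ℕ} {X : ℕ → MMSpace}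

/-- A cover by the ultralimit of `A n` gives a cover by the ultralimit of the cylinders `A n ×ˢ
univ`, which have the same measures. -/
theorem isNull_preimage_fstU {N : Set (UX ω X)} (h : IsNull ω N) :
    IsNull ω ((fstU : UX2 ω X → UX ω X) ⁻¹' N) := fun ε hε => by
  obtain ⟨A, hA, hN, hl⟩ := h ε hε
  refine ⟨fun n => A n ×ˢ univ, fun n => (hA n).prod .univ, fun p hp => ?_, ?_⟩
  · obtain ⟨y, rfl⟩ := p.exists_mk
    exact ((mk_mem_internalSet A fun n => (y n).1).1 (hN hp)).mono fun n hn => ⟨hn, trivial⟩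
  · refine lt_of_le_of_lt (le_of_eq (limMeasure_eq ?_)) hl
    simpa only [Measure.volume_eq_prod, Measure.prod_prod, measure_univ, mul_one]
      using tendsto_limMeasure A

theorem isNull_preimage_sndU {N : Set (UX ω X)} (h : IsNull ω N) :
    IsNull ω ((sndU : UX2 ω X → UX ω X) ⁻¹' N) := fun ε hε => by
  obtain ⟨A, hA, hN, hl⟩ := h ε hε
  refine ⟨fun n => univ ×ˢ A n, fun n => MeasurableSet.univ.prod (hA n), fun p hp => ?_, ?_⟩
  · obtain ⟨y, rfl⟩ := p.exists_mk
    exact ((mk_mem_internalSet A fun n => (y n).2).1 (hN hp)).mono fun n hn => ⟨trivial, hn⟩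
  · refine lt_of_le_of_lt (le_of_eq (limMeasure_eq ?_)) hl
    simpa only [Measure.volume_eq_prod, Measure.prod_prod, measure_univ, one_mul]
      using tendsto_limMeasure A

variable [Nonprincipal ω]

/-- The ultralimit of rectangles is the rectangle of the ultralimits, so the error is contained in
the two cylinders over the null errors of the sides. Measurability and product measure of rectangles
both rest on this. -/
theorem isNull_symmDiff_rectangle {A B : Set (UX ω X)} {P Q : ∀ n, Set (X n)}
    (hA : IsNull ω (A ∆ internalSet ω P)) (hB : IsNull ω (B ∆ internalSet ω Q)) :
    IsNull ω ((splitU ⁻¹' (A ×ˢ B) : Set (UX2 ω X)) ∆ internalSet ω fun n => P n ×ˢ Q n) := by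
  refine ((isNull_preimage_fstU hA).union (isNull_preimage_sndU hB)).mono fun p hp => ?_
  have hr : p ∈ internalSet ω (fun n => P n ×ˢ Q n) ↔
      fstU p ∈ internalSet ω P ∧ sndU p ∈ internalSet ω Q := by
    obtain ⟨y, rfl⟩ := p.exists_mk
    exact eventually_and
  simp only [Set.mem_symmDiff, mem_preimage, splitU, mem_prod, hr, mem_union] at hp ⊢
  tauto

theorem measurable_splitU : Measurable (splitU : UX2 ω X → UX ω X × UX ω X) := by
  refine Measurable.prodMk (fun A hA => ?_) (fun B hB => ?_)
  · obtain ⟨P, hP, h⟩ := id hA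
    refine ⟨fun n => P n ×ˢ univ, fun n => (hP n).prod .univ, ?_⟩
    have := isNull_symmDiff_rectangle h (B := univ) (Q := fun n => univ)
      (by rw [internalSet_univ, symmDiff_self]; exact isNull_empty)
    rw [prod_univ] at this
    exact this
  · obtain ⟨P, hP, h⟩ := id hB
    refine ⟨fun n => univ ×ˢ P n, fun n => MeasurableSet.univ.prod (hP n), ?_⟩
    have := isNull_symmDiff_rectangle (A := univ) (P := fun n => univ)
      (by rw [internalSet_univ, symmDiff_self]; exact isNull_empty) h
    rw [univ_prod] at this
    exact this

/-- The measure of `𝐗²` extends the product measure. -/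
theorem measurePreserving_splitU :
    MeasurePreserving (splitU : UX2 ω X → UX ω X × UX ω X) volume (volume.prod volume) := by
  refine ⟨measurable_splitU, (Measure.prod_eq fun A B hA hB => ?_).symm⟩
  rw [Measure.map_apply measurable_splitU (hA.prod hB)]
  obtain ⟨P, hP, hAP⟩ := id hA
  obtain ⟨Q, hQ, hBQ⟩ := id hB
  rw [volume_eq_limMeasure (fun n => (hP n).prod (hQ n)) (isNull_symmDiff_rectangle hAP hBQ),
    volume_eq_limMeasure hP hAP, volume_eq_limMeasure hQ hBQ]
  refine limMeasure_eq ?_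
  simp only [Measure.volume_eq_prod, Measure.prod_prod]
  have hfin : ∀ A : ∀ n, Set (X n), limMeasure ω A ≠ ⊤ := fun A =>
    ne_top_of_le_ne_top ENNReal.one_ne_top
      (le_of_tendsto (tendsto_limMeasure _) (Eventually.of_forall fun n => prob_le_one))
  exact ENNReal.Tendsto.mul (tendsto_limMeasure P) (Or.inr (hfin Q)) (tendsto_limMeasure Q)
    (Or.inr (hfin P))

theorem measurePreserving_fstU :
    MeasurePreserving (fstU : UX2 ω X → UX ω X) volume volume :=
  measurePreserving_fst.comp measurePreserving_splitU

theorem measurePreserving_sndU :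
    MeasurePreserving (sndU : UX2 ω X → UX ω X) volume volume :=
  measurePreserving_snd.comp measurePreserving_splitU

theorem IsLifting.comp_fstU {Z : Type*} [TopologicalSpace Z] {F : ∀ n, X n → Z}
    {f : UX ω X → Z} (h : IsLifting F f) :
    IsLifting (fun n (p : X n × X n) => F n p.1) fun p : UX2 ω X => f (fstU p) := by
  filter_upwards [measurePreserving_fstU.quasiMeasurePreserving.ae h] with p hp y hy
  subst hy
  exact hp (fun n => (y n).1) rfl

theorem IsLifting.comp_sndU {Z : Type*} [TopologicalSpace Z] {F : ∀ n, X n → Z}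
    {f : UX ω X → Z} (h : IsLifting F f) :
    IsLifting (fun n (p : X n × X n) => F n p.2) fun p : UX2 ω X => f (sndU p) := by
  filter_upwards [measurePreserving_sndU.quasiMeasurePreserving.ae h] with p hp y hy
  subst hy
  exact hp (fun n => (y n).2) rfl

theorem isLifting_ultraDist :
    IsLifting (fun n (p : X n × X n) => (X n).distI p.1 p.2) (ultraDist : UX2 ω X → I) :=
  Eventually.of_forall fun p y hy => by
    subst hy
    exact Ultrafilter.le_nhds_lim (ω.map fun n => (X n).distI (y n).1 (y n).2)

theorem MMSpace.measurable_distI (Y : MMSpace) :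
    Measurable fun p : Y × Y => Y.distI p.1 p.2 :=
  Measurable.subtype_mk (measurable_fst.dist measurable_snd)

theorem aemeasurable_ultraDist : AEMeasurable (ultraDist : UX2 ω X → I) := by
  have h := (isLifting_ultraDist (ω := ω) (X := X)).comp_continuous continuous_subtype_val
  have := (h.aemeasurable_and_tendsto_integral
    (fun n => measurable_subtype_coe.comp (X n).measurable_distI) (C := 1)
    fun n p => abs_le.2 ⟨by have := ((X n).distI p.1 p.2).2.1; linarith,
      ((X n).distI p.1 p.2).2.2⟩).1
  exact MeasurableEmbedding.subtype_coe measurableSet_Icc |>.aemeasurable_comp_iff.1 this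

theorem prodAlgebra_le : (prodAlgebra : MeasurableSpace (UX2 ω X)) ≤ (inferInstance : MeasurableSpace (UX2 ω X)) :=
  measurable_splitU.comap_le

theorem measurable_prodAlgebra_splitU :
    Measurable[prodAlgebra] (splitU : UX2 ω X → UX ω X × UX ω X) :=
  comap_measurable _

end Square

/-! ### Cut norm approximation of the distances -/

section CutNorm

variable {ω : Ultrafilter ℕ} [Nonprincipal ω] {X : ℕ → MMSpace}

/-- The limit of integrals of functions of the distance against functions lifting a function that
is measurable for the product algebra is computed by the derivative of the ultralimit distance. -/
theorem IsDerivativeOfDist.tendsto_integral_mul {dstar : UX2 ω X → ProbabilityMeasure I}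
    (h : IsDerivativeOfDist dstar) (G : C(I, ℝ)) {H : ∀ n, X n × X n → ℝ} {k k' : UX2 ω X → ℝ}
    (hk : IsLifting H k) (hm : ∀ n, Measurable (H n)) {C : ℝ}
    (hC : ∀ (n : ℕ) (p : X n × X n), |H n p| ≤ C) (hk' : Measurable[prodAlgebra] k')
    (hkk' : ∀ᵐ p, k p = k' p) :
    Tendsto (fun n => ∫ p : X n × X n, H n p * G ((X n).distI p.1 p.2)) ω
      (𝓝 (∫ p : UX2 ω X, k p * pairing G (dstar p))) := by
  obtain ⟨D, hD⟩ := exists_abs_le G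
  have hlift := hk.mul (isLifting_ultraDist.comp_continuous G.continuous)
  have hlim := (hlift.aemeasurable_and_tendsto_integral (C := C * D)
    (fun n => (hm n).mul (G.continuous.measurable.comp (X n).measurable_distI))
    (fun n p => by
      rw [abs_mul]
      have := (abs_nonneg _).trans (hC n p)
      gcongr
      · exact hC n p
      · exact hD _)).2
  convert! hlim using 2
  -- The derivative identity needs an exactly `prodAlgebra`-measurable factor, so it is applied to
  -- `k'` and carried back to `k` almost everywhere.
  have key := IsRNDPDerivative.integral_mul_eq prodAlgebra_le h aemeasurable_ultraDist G hk'
    (C := C) (by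
      filter_upwards [hkk', hk.ae_abs_le hC] with p h1 h2
      rwa [← h1])
  calc ∫ p : UX2 ω X, k p * pairing G (dstar p) = ∫ p : UX2 ω X, k' p * pairing G (dstar p) :=
        integral_congr_ae (hkk'.mono fun p hp => by simp only [hp])
    _ = ∫ p : UX2 ω X, k' p * G (ultraDist p) := key.symm
    _ = _ := integral_congr_ae (hkk'.mono fun p hp => by simp only [hp])

/-- The functions `f₁`, `f₂` are measurable on `𝐗` up to null sets, so a modification of their
product in separate variables is `𝓜 × 𝓜`-measurable, and the ultralimit distance may be replaced by
`dstar`. -/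
theorem IsDerivativeOfDist.tendsto_integral {dstar : UX2 ω X → ProbabilityMeasure I}
    (h : IsDerivativeOfDist dstar) (G : C(I, ℝ)) {F₁ F₂ : ∀ n, X n → ℝ} {f₁ f₂ : UX ω X → ℝ}
    (h₁ : IsLifting F₁ f₁) (h₂ : IsLifting F₂ f₂) (hm₁ : ∀ n, Measurable (F₁ n))
    (hm₂ : ∀ n, Measurable (F₂ n)) {C : ℝ} (hC₁ : ∀ n x, |F₁ n x| ≤ C)
    (hC₂ : ∀ n x, |F₂ n x| ≤ C) :
    Tendsto (fun n => ∫ p : X n × X n, F₁ n p.1 * F₂ n p.2 * G ((X n).distI p.1 p.2)) ω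
      (𝓝 (∫ p : UX2 ω X, f₁ (fstU p) * f₂ (sndU p) * pairing G (dstar p))) := by
  have ha₁ := (h₁.aemeasurable_and_tendsto_integral hm₁ hC₁).1
  have ha₂ := (h₂.aemeasurable_and_tendsto_integral hm₂ hC₂).1
  refine h.tendsto_integral_mul G (h₁.comp_fstU.mul h₂.comp_sndU)
    (fun n => ((hm₁ n).comp measurable_fst).mul ((hm₂ n).comp measurable_snd)) (C := C * C)
    (fun n p => ?_) (k' := fun p => ha₁.mk f₁ (fstU p) * ha₂.mk f₂ (sndU p)) ?_ ?_
  · rw [abs_mul]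
    have := (abs_nonneg _).trans (hC₁ n p.1)
    gcongr
    · exact hC₁ n p.1
    · exact hC₂ n p.2
  · exact (((ha₁.measurable_mk.comp measurable_fst).mul
      (ha₂.measurable_mk.comp measurable_snd))).comp measurable_prodAlgebra_splitU
  · filter_upwards [measurePreserving_fstU.quasiMeasurePreserving.ae ha₁.ae_eq_mk,
      measurePreserving_sndU.quasiMeasurePreserving.ae ha₂.ae_eq_mk] with p h1 h2
    rw [h1, h2]

variable {K : Type*} [TopologicalSpace K] [CompactSpace K]
  [SecondCountableTopology K] [MeasurableSpace K] [BorelSpace K]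
  {dstar : UX2 ω X → ProbabilityMeasure I} {Φ : UX ω X → K} {Φn : ∀ n, X n → K}
  {D : K → K → ProbabilityMeasure I}

theorem measurePreserving_pair {Z : Type*} [MeasurableSpace Z] {Φ : UX ω X → Z}
    (hΦ : Measurable Φ) :
    MeasurePreserving (fun p : UX2 ω X => (Φ (fstU p), Φ (sndU p))) volume
      (((volume : Measure (UX ω X)).map Φ).prod ((volume : Measure (UX ω X)).map Φ)) := by
  have h := hΦ.measurePreserving (volume : Measure (UX ω X))
  exact (h.prod h).comp measurePreserving_splitU

theorem integral_comp_pair {Z : Type*} [MeasurableSpace Z] {Φ : UX ω X → Z}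
    (hΦ : Measurable Φ) {h : Z × Z → ℝ} (hm : Measurable h) :
    ∫ p : UX2 ω X, h (Φ (fstU p), Φ (sndU p))
      = ∫ z, h z ∂((volume : Measure (UX ω X)).map Φ).prod ((volume : Measure (UX ω X)).map Φ) := by
  rw [← (measurePreserving_pair hΦ).map_eq,
    integral_map (measurePreserving_pair hΦ).aemeasurable hm.aestronglyMeasurable]

/-- The pairing of a continuous function with a `P[0,1]`-valued distance. -/
def pairFun {Ω : Type*} (D : Ω → Ω → ProbabilityMeasure I) (G : C(I, ℝ)) (z : Ω × Ω) : ℝ :=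
  pairing G (D z.1 z.2)

theorem measurable_pairFun {Ω : Type*} [MeasurableSpace Ω] {D : Ω → Ω → ProbabilityMeasure I}
    (hD : Measurable (Function.uncurry D)) (G : C(I, ℝ)) : Measurable (pairFun D G) :=
  (measurable_pairing G).comp hD

theorem abs_pairFun_le {Ω : Type*} {D : Ω → Ω → ProbabilityMeasure I} {G : C(I, ℝ)} {C : ℝ}
    (hG : ∀ t, |G t| ≤ C) (z : Ω × Ω) : |pairFun D G z| ≤ C :=
  abs_pairing_le hG _

/-- Ultralimits of cut norm pairings are bounded by the `L¹` distance in the realization. -/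
theorem exists_tendsto_cut (hdstar : IsDerivativeOfDist dstar) (hΦ : Measurable Φ)
    (hΦn : ∀ n, Measurable (Φn n)) (hlift : IsLifting Φn Φ) (hD : Measurable (Function.uncurry D))
    (hpull : ∀ᵐ p : UX2 ω X, D (Φ (fstU p)) (Φ (sndU p)) = dstar p) (G : C(I, ℝ))
    (w : C(K × K, ℝ)) {F₁ F₂ : ∀ n, X n → ℝ} (hm₁ : ∀ n, Measurable (F₁ n))
    (hm₂ : ∀ n, Measurable (F₂ n)) (hC₁ : ∀ (n : ℕ) (x : X n), |F₁ n x| ≤ 1)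
    (hC₂ : ∀ (n : ℕ) (x : X n), |F₂ n x| ≤ 1) :
    ∃ L : ℝ, |L| ≤ ∫ z, |pairFun D G z - w z|
        ∂((volume : Measure (UX ω X)).map Φ).prod ((volume : Measure (UX ω X)).map Φ) ∧
      Tendsto (fun n => ∫ p : X n × X n, (G ((X n).distI p.1 p.2) - w (Φn n p.1, Φn n p.2)) *
        (F₁ n p.1 * F₂ n p.2)) ω (𝓝 L) := by
  obtain ⟨f₁, hf₁, hl₁⟩ := exists_isLifting (ω := ω) hC₁
  obtain ⟨f₂, hf₂, hl₂⟩ := exists_isLifting (ω := ω) hC₂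
  obtain ⟨CG, hCG⟩ := exists_abs_le G
  have hCw : ∀ z, |w z| ≤ ‖w‖ := fun z => w.norm_coe_le_norm z
  have hprod : ∀ a b : ℝ, |a| ≤ 1 → |b| ≤ 1 → |a * b| ≤ 1 := fun a b ha hb => by
    rw [abs_mul]
    exact mul_le_one₀ ha (abs_nonneg _) hb
  have hprod' : ∀ a b c C : ℝ, |a| ≤ 1 → |b| ≤ 1 → |c| ≤ C → |a * b * c| ≤ C :=
    fun a b c C ha hb hc => by
      rw [abs_mul]
      exact (mul_le_of_le_one_left (abs_nonneg _) (hprod a b ha hb)).trans hc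
  have t₁ := hdstar.tendsto_integral G hl₁ hl₂ hm₁ hm₂ hC₁ hC₂
  have hlw := (hl₁.comp_fstU.mul hl₂.comp_sndU).mul
    ((hlift.comp_fstU.prodMk hlift.comp_sndU).comp_continuous w.continuous)
  have hmw : ∀ n, Measurable fun p : X n × X n => F₁ n p.1 * F₂ n p.2 * w (Φn n p.1, Φn n p.2) :=
    fun n => (((hm₁ n).comp measurable_fst).mul ((hm₂ n).comp measurable_snd)).mul
      (w.continuous.measurable.comp (((hΦn n).comp measurable_fst).prodMk
        ((hΦn n).comp measurable_snd)))
  obtain ⟨aw, t₂⟩ := hlw.aemeasurable_and_tendsto_integral hmw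
    (fun n p => hprod' _ _ _ _ (hC₁ n p.1) (hC₂ n p.2) (hCw _))
  have hpm := measurable_pairFun hD G
  have hpm' : Measurable fun p : UX2 ω X => pairFun D G (Φ (fstU p), Φ (sndU p)) :=
    hpm.comp ((hΦ.prodMap hΦ).comp measurable_splitU)
  have ha₁ := (hl₁.aemeasurable_and_tendsto_integral hm₁ hC₁).1
  have ha₂ := (hl₂.aemeasurable_and_tendsto_integral hm₂ hC₂).1
  have a₁ : AEMeasurable fun p : UX2 ω X => f₁ (fstU p) :=
    ha₁.comp_quasiMeasurePreserving measurePreserving_fstU.quasiMeasurePreserving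
  have a₂ : AEMeasurable fun p : UX2 ω X => f₂ (sndU p) :=
    ha₂.comp_quasiMeasurePreserving measurePreserving_sndU.quasiMeasurePreserving
  -- The limit pairs the ultralimits of the test functions with the difference in the realization;
  -- as both are bounded by one, its absolute value is at most the `L¹` norm of the difference.
  refine ⟨∫ p : UX2 ω X, f₁ (fstU p) * f₂ (sndU p) *
    (pairFun D G (Φ (fstU p), Φ (sndU p)) - w (Φ (fstU p), Φ (sndU p))), ?_, ?_⟩
  · have habs : Measurable fun z => |pairFun D G z - w z| := (hpm.sub w.continuous.measurable).abs
    rw [← integral_comp_pair hΦ habs]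
    refine (abs_integral_le_integral_abs).trans (integral_mono_of_nonneg
      (Eventually.of_forall fun p => abs_nonneg _) ?_ (Eventually.of_forall fun p => ?_))
    · refine integrable_of_measurable_of_abs_le
        (habs.comp ((hΦ.prodMap hΦ).comp measurable_splitU)) (C := CG + ‖w‖) fun p => ?_
      rw [abs_abs]
      exact (abs_sub _ _).trans (add_le_add (abs_pairFun_le hCG _) (hCw _))
    · exact hprod' _ _ _ _ (hf₁ _) (hf₂ _) le_rfl
  · have i₁ : Integrable fun p : UX2 ω X =>
        f₁ (fstU p) * f₂ (sndU p) * pairFun D G (Φ (fstU p), Φ (sndU p)) :=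
      Integrable.of_bound ((a₁.mul a₂).mul hpm'.aemeasurable).aestronglyMeasurable CG
        (Eventually.of_forall fun p => hprod' _ _ _ _ (hf₁ _) (hf₂ _) (abs_pairFun_le hCG _))
    have i₂ : Integrable fun p : UX2 ω X =>
        f₁ (fstU p) * f₂ (sndU p) * w (Φ (fstU p), Φ (sndU p)) :=
      Integrable.of_bound aw.aestronglyMeasurable ‖w‖
        (Eventually.of_forall fun p => hprod' _ _ _ _ (hf₁ _) (hf₂ _) (hCw _))
    have e : ∫ p : UX2 ω X, f₁ (fstU p) * f₂ (sndU p) * pairing G (dstar p)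
        = ∫ p : UX2 ω X, f₁ (fstU p) * f₂ (sndU p) * pairFun D G (Φ (fstU p), Φ (sndU p)) := by
      refine integral_congr_ae (hpull.mono fun p hp => ?_)
      simp only [pairFun, hp]
    rw [e] at t₁
    simp only [mul_sub]
    rw [integral_sub i₁ i₂]
    refine (t₁.sub t₂).congr fun n => ?_
    rw [← integral_sub]
    · refine integral_congr_ae (Eventually.of_forall fun p => ?_)
      simp only
      ring
    · exact integrable_of_measurable_of_abs_le
        ((((hm₁ n).comp measurable_fst).mul ((hm₂ n).comp measurable_snd)).mul
          (G.continuous.measurable.comp (X n).measurable_distI))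
        fun p => hprod' _ _ _ _ (hC₁ n p.1) (hC₂ n p.2) (hCG _)
    · exact integrable_of_measurable_of_abs_le (hmw n)
        fun p => hprod' _ _ _ _ (hC₁ n p.1) (hC₂ n p.2) (hCw _)

/-- Uniformity in the test functions comes from selecting violators: if the bound failed for almost
all `n`, the pairings with the selected functions would have an ultralimit of absolute value at
least `δ`, against `exists_tendsto_cut`. -/
theorem eventually_cut_le (hdstar : IsDerivativeOfDist dstar) (hΦ : Measurable Φ)
    (hΦn : ∀ n, Measurable (Φn n)) (hlift : IsLifting Φn Φ) (hD : Measurable (Function.uncurry D))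
    (hpull : ∀ᵐ p : UX2 ω X, D (Φ (fstU p)) (Φ (sndU p)) = dstar p) (G : C(I, ℝ))
    (w : C(K × K, ℝ)) {δ : ℝ}
    (hδ : ∫ z, |pairFun D G z - w z|
      ∂((volume : Measure (UX ω X)).map Φ).prod ((volume : Measure (UX ω X)).map Φ) < δ) :
    ∀ᶠ n in (ω : Filter ℕ), ∀ f g : X n → ℝ, Measurable f → Measurable g → (∀ a, |f a| ≤ 1) →
      (∀ a, |g a| ≤ 1) → |∫ p : X n × X n, (G ((X n).distI p.1 p.2) - w (Φn n p.1, Φn n p.2)) *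
        (f p.1 * g p.2)| ≤ δ := by
  by_contra hcon
  have hcon' := Ultrafilter.eventually_not.2 hcon
  have hex : ∀ n, ∃ fg : (X n → ℝ) × (X n → ℝ), (Measurable fg.1 ∧ Measurable fg.2 ∧
      (∀ a, |fg.1 a| ≤ 1) ∧ ∀ a, |fg.2 a| ≤ 1) ∧
      ((¬ ∀ f g : X n → ℝ, Measurable f → Measurable g → (∀ a, |f a| ≤ 1) →
      (∀ a, |g a| ≤ 1) → |∫ p : X n × X n, (G ((X n).distI p.1 p.2) - w (Φn n p.1, Φn n p.2)) *
        (f p.1 * g p.2)| ≤ δ) → δ < |∫ p : X n × X n, (G ((X n).distI p.1 p.2) -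
          w (Φn n p.1, Φn n p.2)) * (fg.1 p.1 * fg.2 p.2)|) := by
    intro n
    by_cases hn : ∀ f g : X n → ℝ, Measurable f → Measurable g → (∀ a, |f a| ≤ 1) →
      (∀ a, |g a| ≤ 1) → |∫ p : X n × X n, (G ((X n).distI p.1 p.2) - w (Φn n p.1, Φn n p.2)) *
        (f p.1 * g p.2)| ≤ δ
    -- Where the bound holds, zero functions serve as placeholders so that the sequence is defined
    -- for every `n`.
    · exact ⟨(0, 0), ⟨measurable_zero, measurable_zero, by simp, by simp⟩, fun h => absurd hn h⟩
    · obtain ⟨f, g, hf, hg, hf1, hg1, h⟩ : ∃ f g : X n → ℝ, Measurable f ∧ Measurable g ∧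
          (∀ a, |f a| ≤ 1) ∧ (∀ a, |g a| ≤ 1) ∧ δ < |∫ p : X n × X n,
            (G ((X n).distI p.1 p.2) - w (Φn n p.1, Φn n p.2)) * (f p.1 * g p.2)| := by
        push Not at hn
        exact hn
      exact ⟨(f, g), ⟨hf, hg, hf1, hg1⟩, fun _ => h⟩
  choose fg hfg hbad using hex
  obtain ⟨L, hL, hlim⟩ := exists_tendsto_cut hdstar hΦ hΦn hlift hD hpull G w
    (fun n => (hfg n).1) (fun n => (hfg n).2.1) (fun n => (hfg n).2.2.1) (fun n => (hfg n).2.2.2)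
  have := ge_of_tendsto hlim.abs (hcon'.mono fun n hn => (hbad n hn).le)
  linarith

end CutNorm

/-! ### Continuous approximation and integrals against sampling measures -/

section Sampling

open ProbabilityTheory

/-- Bounded measurable functions are approximated in `L¹` by continuous functions with the same
bound. -/
theorem exists_continuous_integral_abs_sub_lt {E : Type*} [TopologicalSpace E] [T2Space E]
    [CompactSpace E] [SecondCountableTopology E] [MeasurableSpace E] [BorelSpace E] (P : Measure E)
    [IsProbabilityMeasure P] {h : E → ℝ} (hm : Measurable h) (h1 : ∀ z, |h z| ≤ 1) {δ : ℝ}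
    (hδ : 0 < δ) :
    ∃ w : C(E, ℝ), (∀ z, |w z| ≤ 1) ∧ ∫ z, |h z - w z| ∂P < δ := by
  obtain ⟨g, -, hg, hgc, hgi⟩ := (integrable_of_measurable_of_abs_le (P := P) hm
    h1).exists_hasCompactSupport_integral_sub_le (half_pos hδ)
  -- Truncating to `[-1,1]` restores the bound and does not increase the distance to `h`, whose
  -- values already lie there.
  have hwc : Continuous fun z => max (min (g z) 1) (-1) := by fun_prop
  have hw : ∀ z, |max (min (g z) 1) (-1)| ≤ 1 := fun z =>
    abs_le.2 ⟨le_max_right _ _, max_le (min_le_right _ _) (by norm_num)⟩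
  refine ⟨⟨_, hwc⟩, hw, ?_⟩
  refine lt_of_le_of_lt ?_ (lt_of_le_of_lt hg (half_lt_self hδ))
  refine integral_mono_of_nonneg (Eventually.of_forall fun z => abs_nonneg _)
    ((integrable_of_measurable_of_abs_le hm h1).sub hgi).norm (Eventually.of_forall fun z => ?_)
  have hz := abs_le.1 (h1 z)
  simp only [ContinuousMap.coe_mk, Real.norm_eq_abs]
  have e : h z = max (min (h z) 1) (-1) := by rw [min_eq_left hz.2, max_eq_left hz.1]
  calc |h z - max (min (g z) 1) (-1)| = |max (min (h z) 1) (-1) - max (min (g z) 1) (-1)| := by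
        rw [← e]
    _ ≤ |min (h z) 1 - min (g z) 1| := abs_max_sub_max_le_abs _ _ _
    _ ≤ |h z - g z| := (abs_min_sub_min_le_max _ _ _ _).trans_eq (by simp)

theorem assemble_apply (l : Pairs → I) (p : Pairs) : (assemble l).1 p.1.1 p.1.2 = l p := by
  simp [assemble, p.2]

/-- Distance matrices are determined by the entries above the diagonal. -/
theorem DistMatrix.ext_pairs {m m' : DistMatrix}
    (h : ∀ p : Pairs, m.1 p.1.1 p.1.2 = m'.1 p.1.1 p.1.2) : m = m' := by
  refine Subtype.ext (funext fun i => funext fun j => ?_)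
  rcases lt_trichotomy i j with hij | rfl | hij
  · exact h ⟨(i, j), hij⟩
  · rw [m.2.2, m'.2.2]
  · rw [m.2.1 i j, m'.2.1 i j]
    exact h ⟨(j, i), hij⟩

/-- The entry of a distance matrix at a pair of indices. -/
def entry (p : Pairs) : C(DistMatrix, I) :=
  ⟨fun m => m.1 p.1.1 p.1.2,
    (continuous_apply p.1.2).comp ((continuous_apply p.1.1).comp continuous_subtype_val)⟩

instance : CompactSpace DistMatrix := by
  refine isCompact_iff_compactSpace.1 (IsClosed.isCompact ?_)
  refine IsClosed.and ?_ ?_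
  · simp only [ofPred_forall]
    exact isClosed_iInter fun i => isClosed_iInter fun j =>
      isClosed_eq (by fun_prop) (by fun_prop)
  · simp only [ofPred_forall]
    exact isClosed_iInter fun i => isClosed_eq (by fun_prop) (by fun_prop)

theorem integral_prod_entry_sampling (Y : MMSpace) (s : Finset Pairs) (G : Pairs → C(I, ℝ)) :
    ∫ m, ∏ p ∈ s, G p (entry p m) ∂(Y.sampling : Measure DistMatrix)
      = ∫ x, ∏ p ∈ s, G p (Y.distI (pairAt x p).1 (pairAt x p).2)
          ∂Measure.infinitePi fun _ : ℕ => (volume : Measure Y) := by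
  have hc : Continuous fun m : DistMatrix => ∏ p ∈ s, G p (entry p m) := by fun_prop
  exact integral_map Y.measurable_matrixOf.aemeasurable hc.aestronglyMeasurable

variable {Ω : Type*} [MeasurableSpace Ω]

/-- The Markov kernel from sequences of points to distance matrices. -/
def matrixKernel {d : Ω → Ω → ProbabilityMeasure I} (hd : Measurable (Function.uncurry d)) :
    Kernel (ℕ → Ω) DistMatrix :=
  ⟨fun x => matrixLaw (qMatrixOf d x), measurable_matrixLaw.comp (measurable_qMatrixOf hd)⟩

instance {d : Ω → Ω → ProbabilityMeasure I} (hd : Measurable (Function.uncurry d)) :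
    IsMarkovKernel (matrixKernel hd) :=
  ⟨fun x => inferInstanceAs (IsProbabilityMeasure (matrixLaw (qMatrixOf d x)))⟩

/-- The barycenter is the composition of `matrixKernel` with a constant kernel, so the integral over
a composition of kernels applies. -/
theorem integral_qSampling (μ : ProbabilityMeasure Ω) {d : Ω → Ω → ProbabilityMeasure I}
    (hd : Measurable (Function.uncurry d)) (F : C(DistMatrix, ℝ)) :
    ∫ m, F m ∂(qSampling μ d hd : Measure DistMatrix)
      = ∫ x, ∫ m, F m ∂matrixLaw (qMatrixOf d x) ∂Measure.infinitePi fun _ => (μ : Measure Ω) := by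
  have hi : ∀ (P : Measure DistMatrix) [IsProbabilityMeasure P], Integrable F P := fun P _ =>
    (BoundedContinuousFunction.mkOfCompact F).integrable P
  have := Kernel.integral_comp (η := matrixKernel hd)
    (κ := Kernel.const Unit (Measure.infinitePi fun _ : ℕ => (μ : Measure Ω))) (a := ())
    (f := F) (hi _)
  rw [Kernel.comp_apply, Kernel.const_apply] at this
  exact this

/-- Given the points, the entries are independent, so the inner integral of the product is the
product of the pairings. -/
theorem integral_prod_entry_qSampling (μ : ProbabilityMeasure Ω)
    {d : Ω → Ω → ProbabilityMeasure I} (hd : Measurable (Function.uncurry d)) (s : Finset Pairs)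
    (G : Pairs → C(I, ℝ)) :
    ∫ m, ∏ p ∈ s, G p (entry p m) ∂(qSampling μ d hd : Measure DistMatrix)
      = ∫ x, ∏ p ∈ s, pairFun d (G p) (pairAt x p)
          ∂Measure.infinitePi fun _ => (μ : Measure Ω) := by
  have hc : Continuous fun m : DistMatrix => ∏ p ∈ s, G p (entry p m) := by fun_prop
  refine (integral_qSampling μ hd ⟨_, hc⟩).trans ?_
  congr 1
  ext x
  refine (integral_map measurable_assemble.aemeasurable hc.aestronglyMeasurable).trans ?_
  simp only [entry, ContinuousMap.coe_mk, assemble_apply]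
  exact integral_finset_prod_infinitePi _ s fun p => (G p).continuous.measurable

end Sampling

/-! ### Sampling convergence and symmetry for a realization with a lifting -/

section Realization

open ProbabilityTheory

variable {ω : Ultrafilter ℕ} [Nonprincipal ω] {X : ℕ → MMSpace}
  {K : Type*} [TopologicalSpace K] [CompactSpace K] [T2Space K]
  [SecondCountableTopology K] [MeasurableSpace K] [BorelSpace K]
  {dstar : UX2 ω X → ProbabilityMeasure I} {Φ : UX ω X → K} {Φn : ∀ n, X n → K}
  {D : K → K → ProbabilityMeasure I}

/-- Convergence of the sampling integrals, for a realization in a compact space whose map has a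
measurable lifting. -/
theorem tendsto_integral_prod_dist (hdstar : IsDerivativeOfDist dstar) (hΦ : Measurable Φ)
    (hΦn : ∀ n, Measurable (Φn n)) (hlift : IsLifting Φn Φ) (hD : Measurable (Function.uncurry D))
    (hpull : ∀ᵐ p : UX2 ω X, D (Φ (fstU p)) (Φ (sndU p)) = dstar p) (s : Finset Pairs)
    (G : Pairs → C(I, ℝ)) (hG : ∀ q t, |G q t| ≤ 1) :
    Tendsto (fun n => ∫ x, ∏ q ∈ s, G q ((X n).distI (pairAt x q).1 (pairAt x q).2)
        ∂Measure.infinitePi fun _ : ℕ => (volume : Measure (X n))) ω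
      (𝓝 (∫ y, ∏ q ∈ s, pairFun D (G q) (pairAt y q)
        ∂Measure.infinitePi fun _ : ℕ => (volume : Measure (UX ω X)).map Φ)) := by
  have hν : IsProbabilityMeasure ((volume : Measure (UX ω X)).map Φ) :=
    Measure.isProbabilityMeasure_map hΦ.aemeasurable
  have hνn : ∀ n, IsProbabilityMeasure ((volume : Measure (X n)).map (Φn n)) := fun n =>
    Measure.isProbabilityMeasure_map (hΦn n).aemeasurable
  refine tendsto_of_forall_approx fun ε hε => ?_
  -- The counting lemma loses `δ` per factor; adding one keeps the denominator positive when `s` is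
  -- empty.
  set δ : ℝ := ε / (s.card + 1) with hδ
  have hδ0 : 0 < δ := by positivity
  have hsδ : s.card * δ ≤ ε := by
    have : (s.card : ℝ) / (s.card + 1) ≤ 1 := (div_le_one (by positivity)).2 (by linarith)
    calc s.card * δ = (s.card : ℝ) / (s.card + 1) * ε := by rw [hδ]; ring
      _ ≤ ε := mul_le_of_le_one_left hε.le this
  choose w hw1 hwδ using fun q => exists_continuous_integral_abs_sub_lt
    (((volume : Measure (UX ω X)).map Φ).prod ((volume : Measure (UX ω X)).map Φ))
    (measurable_pairFun hD (G q)) (abs_pairFun_le (hG q)) hδ0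
  have hpairΦ : ∀ n, Measurable fun p : X n × X n => (Φn n p.1, Φn n p.2) := fun n =>
    ((hΦn n).comp measurable_fst).prodMk ((hΦn n).comp measurable_snd)
  let W : C(ℕ → K, ℝ) := ⟨fun y => ∏ q ∈ s, w q (pairAt y q), by
    refine continuous_finsetProd _ fun q _ => (w q).continuous.comp ?_
    exact (continuous_apply _).prodMk (continuous_apply _)⟩
  refine ⟨fun n => ∫ x, ∏ q ∈ s, w q (Φn n (pairAt x q).1, Φn n (pairAt x q).2)
      ∂Measure.infinitePi fun _ : ℕ => (volume : Measure (X n)),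
    ∫ y, ∏ q ∈ s, w q (pairAt y q)
      ∂Measure.infinitePi fun _ : ℕ => (volume : Measure (UX ω X)).map Φ, ?_, ?_, ?_⟩
  -- The approximating integrand depends continuously on the points `Φn n (x i)`, an independent
  -- sample from the law of `Φn n`. These laws converge weakly to the law of `Φ`.
  · have hlim := tendsto_integral_infinitePi (l := (ω : Filter ℕ))
      (P := fun n => ⟨(volume : Measure (X n)).map (Φn n), hνn n⟩)
      (Q := ⟨(volume : Measure (UX ω X)).map Φ, hν⟩) (fun f => by
        simp only [ProbabilityMeasure.coe_mk]
        rw [integral_map hΦ.aemeasurable f.continuous.measurable.aestronglyMeasurable]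
        refine ((hlift.comp_continuous f.continuous).aemeasurable_and_tendsto_integral
          (fun n => f.continuous.measurable.comp (hΦn n))
          (fun n x => f.norm_coe_le_norm _)).2.congr fun n => ?_
        exact (integral_map (hΦn n).aemeasurable
          f.continuous.measurable.aestronglyMeasurable).symm) W
    refine hlim.congr fun n => ?_
    simp only [ProbabilityMeasure.coe_mk]
    rw [← Measure.infinitePi_map_pi (fun _ : ℕ => (volume : Measure (X n))) (fun _ => hΦn n)]
    refine (integral_map (Measurable.aemeasurable ?_)
      W.continuous.measurable.aestronglyMeasurable).trans rfl
    exact measurable_pi_lambda _ fun i => (hΦn n).comp (measurable_pi_apply i)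
  · have hev : ∀ᶠ n in (ω : Filter ℕ), ∀ q ∈ s, ∀ f g : X n → ℝ, Measurable f → Measurable g →
        (∀ a, |f a| ≤ 1) → (∀ a, |g a| ≤ 1) →
        |∫ p : X n × X n, (G q ((X n).distI p.1 p.2) - w q (Φn n p.1, Φn n p.2)) *
          (f p.1 * g p.2)| ≤ δ :=
      (Filter.eventually_all_finset s).2 fun q _ =>
        eventually_cut_le hdstar hΦ hΦn hlift hD hpull (G q) (w q) (hwδ q)
    filter_upwards [hev] with n hn
    exact (abs_integral_prod_sub_le (volume : Measure (X n)) s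
      (u := fun q p => G q ((X n).distI p.1 p.2)) (v := fun q p => w q (Φn n p.1, Φn n p.2))
      (fun q => (G q).continuous.measurable.comp (X n).measurable_distI)
      (fun q => (w q).continuous.measurable.comp (hpairΦ n)) (fun q z => hG q _)
      (fun q z => hw1 q _) hn).trans hsδ
  -- On the limit side the cut norm is bounded by the `L¹` distance, so the counting lemma applies
  -- again.
  · refine (abs_integral_prod_sub_le _ s (u := fun q => pairFun D (G q)) (v := fun q => w q)
      (fun q => measurable_pairFun hD (G q)) (fun q => (w q).continuous.measurable)
      (fun q => abs_pairFun_le (hG q)) hw1 fun q _ f g hf hg hf1 hg1 => ?_).trans hsδ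
    refine le_trans (abs_integral_le_integral_abs.trans ?_) (hwδ q).le
    refine integral_mono_of_nonneg (Eventually.of_forall fun z => abs_nonneg _) ?_
      (Eventually.of_forall fun z => ?_)
    · refine integrable_of_measurable_of_abs_le (C := 1 + 1)
        ((measurable_pairFun hD (G q)).sub (w q).continuous.measurable).abs fun z => ?_
      rw [abs_abs]
      exact (abs_sub _ _).trans (add_le_add (abs_pairFun_le (hG q) _) (hw1 q _))
    · simp only [abs_mul]
      exact mul_le_of_le_one_right (abs_nonneg _)
        (mul_le_one₀ (hf1 _) (abs_nonneg _) (hg1 _))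

/-- The derivative of the ultralimit distance is symmetric. -/
theorem ae_symm_of_isLifting (hdstar : IsDerivativeOfDist dstar) (hΦ : Measurable Φ)
    (hΦn : ∀ n, Measurable (Φn n)) (hlift : IsLifting Φn Φ) (hD : Measurable (Function.uncurry D))
    (hpull : ∀ᵐ p : UX2 ω X, D (Φ (fstU p)) (Φ (sndU p)) = dstar p) :
    ∀ᵐ z ∂((volume : Measure (UX ω X)).map Φ).prod ((volume : Measure (UX ω X)).map Φ),
      D z.1 z.2 = D z.2 z.1 := by
  have hν : IsProbabilityMeasure ((volume : Measure (UX ω X)).map Φ) :=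
    Measure.isProbabilityMeasure_map hΦ.aemeasurable
  set ν := (volume : Measure (UX ω X)).map Φ with hνdef
  -- Each side of the symmetry becomes an ultralimit of integrals over `X n × X n`, where swapping
  -- the two points leaves the distance unchanged.
  have hlim : ∀ (f : C(K × K, ℝ)) (G : C(I, ℝ)),
      Tendsto (fun n => ∫ p : X n × X n, f (Φn n p.1, Φn n p.2) * G ((X n).distI p.1 p.2)) ω
        (𝓝 (∫ z, f z * pairFun D G z ∂ν.prod ν)) := fun f G => by
    have := hdstar.tendsto_integral_mul G
      ((hlift.comp_fstU.prodMk hlift.comp_sndU).comp_continuous f.continuous)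
      (fun n => f.continuous.measurable.comp (((hΦn n).comp measurable_fst).prodMk
        ((hΦn n).comp measurable_snd))) (fun n p => f.norm_coe_le_norm _)
      ((f.continuous.measurable.comp (hΦ.prodMap hΦ)).comp measurable_prodAlgebra_splitU)
      (Eventually.of_forall fun p => rfl)
    convert! this using 2
    have hfm : Measurable fun z => f z * pairFun D G z :=
      f.continuous.measurable.mul (measurable_pairFun hD G)
    rw [hνdef, ← integral_comp_pair hΦ hfm]
    refine integral_congr_ae (hpull.mono fun p hp => ?_)
    simp only [pairFun, hp]
  have hsymm : ∀ (f : C(K × K, ℝ)) (G : C(I, ℝ)),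
      ∫ z, f z * pairFun D G z ∂ν.prod ν = ∫ z, f z * pairFun D G z.swap ∂ν.prod ν := fun f G => by
    have h1 := hlim (f.comp ⟨Prod.swap, continuous_swap⟩) G
    have h2 := tendsto_nhds_unique (hlim f G) (h1.congr fun n => ?_)
    · rw [h2, ← integral_prod_swap]
      rfl
    · rw [Measure.volume_eq_prod, ← integral_prod_swap]
      refine integral_congr_ae (Eventually.of_forall fun p => ?_)
      have : (X n).distI p.2 p.1 = (X n).distI p.1 p.2 := Subtype.ext (dist_comm _ _)
      simp only [ContinuousMap.comp_apply, ContinuousMap.coe_mk, Prod.swap, this]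
  let κ : Kernel (K × K) I := ⟨fun z => (D z.1 z.2 : Measure I), measurable_subtype_coe.comp hD⟩
  let κ' : Kernel (K × K) I :=
    ⟨fun z => (D z.2 z.1 : Measure I), measurable_subtype_coe.comp (hD.comp measurable_swap)⟩
  have : IsMarkovKernel κ := ⟨fun z => inferInstanceAs (IsProbabilityMeasure (D z.1 z.2 : Measure I))⟩
  have : IsMarkovKernel κ' := ⟨fun z => inferInstanceAs (IsProbabilityMeasure (D z.2 z.1 : Measure I))⟩
  -- Equality of integrals for all `f` and `G` identifies the joint laws of pair and length, and
  -- disintegration is unique almost everywhere.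
  have hcomp : (ν.prod ν) ⊗ₘ κ = (ν.prod ν) ⊗ₘ κ' := by
    refine Measure.ext_of_integral_mul_boundedContinuousFunction fun f G => ?_
    have hi : ∀ (η : Kernel (K × K) I) [IsMarkovKernel η],
        Integrable (fun p => f p.1 * G p.2) ((ν.prod ν) ⊗ₘ η) := fun η _ => by
      refine integrable_of_measurable_of_abs_le (C := ‖f‖ * ‖G‖)
        ((f.continuous.measurable.comp measurable_fst).mul
          (G.continuous.measurable.comp measurable_snd)) fun p => ?_
      rw [abs_mul]
      exact mul_le_mul (f.norm_coe_le_norm _) (G.norm_coe_le_norm _) (abs_nonneg _) (norm_nonneg _)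
    rw [Measure.integral_compProd (hi κ), Measure.integral_compProd (hi κ')]
    simp only [integral_const_mul]
    exact hsymm f.toContinuousMap G.toContinuousMap
  filter_upwards [Kernel.ae_eq_of_compProd_eq hcomp] with z hz
  exact Subtype.ext hz

end Realization

/-! ### The random triangle inequality -/

section Triangle

open ProbabilityTheory

/-- Needed at two levels: for three points of the random sequence, and for three entries of the
matrix given the points. -/
theorem infinitePi_map_triple {ι Z : Type*} [MeasurableSpace Z] (μ : ι → Measure Z)
    [∀ i, IsProbabilityMeasure (μ i)] {a b c : ι} (hab : a ≠ b) (hac : a ≠ c) (hbc : b ≠ c) :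
    (Measure.infinitePi μ).map (fun x => (x a, x b, x c)) = (μ a).prod ((μ b).prod (μ c)) := by
  classical
  have hm : Measurable fun x : ι → Z => (x a, x b, x c) :=
    (measurable_pi_apply a).prodMk ((measurable_pi_apply b).prodMk (measurable_pi_apply c))
  have : IsProbabilityMeasure ((Measure.infinitePi μ).map fun x => (x a, x b, x c)) :=
    Measure.isProbabilityMeasure_map hm.aemeasurable
  refine Measure.ext_prod₃ fun {A B C} hA hB hC => ?_
  rw [Measure.map_apply hm (hA.prod (hB.prod hC)), Measure.prod_prod, Measure.prod_prod]
  let t : ι → Set Z := fun i => if i = a then A else if i = b then B else C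
  have ha : t a = A := by simp [t]
  have hb : t b = B := by simp [t, hab.symm]
  have hc : t c = C := by simp [t, hac.symm, hbc.symm]
  have ht : ∀ i, MeasurableSet (t i) := fun i => by
    simp only [t]
    split_ifs <;> assumption
  have : (fun x : ι → Z => (x a, x b, x c)) ⁻¹' A ×ˢ B ×ˢ C
      = (({a, b, c} : Finset ι) : Set ι).pi t := by
    ext x
    simp [ha, hb, hc]
  rw [this, Measure.infinitePi_pi _ fun i _ => ht i, Finset.prod_insert (by simp [hab, hac]),
    Finset.prod_insert (by simp [hbc]), Finset.prod_singleton, ha, hb, hc]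

/-- The triples of lengths satisfying the three triangle inequalities. -/
def triangleSet : Set (I × I × I) :=
  {l | (l.2.2 : ℝ) ≤ l.1 + l.2.1 ∧ (l.1 : ℝ) ≤ l.2.1 + l.2.2 ∧ (l.2.1 : ℝ) ≤ l.1 + l.2.2}

theorem measurableSet_triangleSet : MeasurableSet triangleSet := by
  refine IsClosed.measurableSet (IsClosed.and ?_ (IsClosed.and ?_ ?_)) <;>
  exact isClosed_le (by fun_prop) (by fun_prop)

variable {Ω : Type*} [MeasurableSpace Ω]

/-- The kernel of the three side lengths of a triple of points. -/
def sideKernel {d : Ω → Ω → ProbabilityMeasure I} (hd : Measurable (Function.uncurry d)) :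
    Kernel (Ω × Ω × Ω) (I × I × I) :=
  let κ : Kernel (Ω × Ω) I := ⟨fun z => (d z.1 z.2 : Measure I), measurable_subtype_coe.comp hd⟩
  (κ.comap (fun p => (p.1, p.2.1)) (by fun_prop)) ×ₖ
    ((κ.comap (fun p => (p.2.1, p.2.2)) (by fun_prop)) ×ₖ
      (κ.comap (fun p => (p.1, p.2.2)) (by fun_prop)))

theorem sideKernel_apply {d : Ω → Ω → ProbabilityMeasure I}
    (hd : Measurable (Function.uncurry d)) (p : Ω × Ω × Ω) :
    sideKernel hd p = (d p.1 p.2.1 : Measure I).prod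
      ((d p.2.1 p.2.2 : Measure I).prod (d p.1 p.2.2 : Measure I)) := by
  let κ : Kernel (Ω × Ω) I := ⟨fun z => (d z.1 z.2 : Measure I), measurable_subtype_coe.comp hd⟩
  have : IsMarkovKernel κ :=
    ⟨fun z => inferInstanceAs (IsProbabilityMeasure (d z.1 z.2 : Measure I))⟩
  show ((κ.comap (fun p => (p.1, p.2.1)) (by fun_prop)) ×ₖ
    ((κ.comap (fun p => (p.2.1, p.2.2)) (by fun_prop)) ×ₖ
      (κ.comap (fun p => (p.1, p.2.2)) (by fun_prop)))) p = _
  rw [Kernel.prod_apply, Kernel.prod_apply]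
  rfl

/-- The pair of indices `i < j`. -/
abbrev pairIdx (i j : ℕ) (h : i < j) : Pairs := ⟨(i, j), h⟩

/-- The side lengths of the first three points. -/
def sides (m : DistMatrix) : I × I × I := (m.1 0 1, m.1 1 2, m.1 0 2)

theorem continuous_sides : Continuous sides :=
  (entry (pairIdx 0 1 (by norm_num))).continuous.prodMk
    ((entry (pairIdx 1 2 (by norm_num))).continuous.prodMk
      (entry (pairIdx 0 2 (by norm_num))).continuous)

/-- Weak limits of sampling measures of metric spaces satisfy the random triangle inequality. -/
theorem randomTriangle_of_tendsto {ι : Type*} {l : Filter ι} [l.NeBot] {X : ι → MMSpace}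
    {μ : ProbabilityMeasure Ω} {d : Ω → Ω → ProbabilityMeasure I}
    {hd : Measurable (Function.uncurry d)}
    (h : Tendsto (fun n => (X n).sampling) l (𝓝 (qSampling μ d hd))) : RandomTriangle μ d := by
  -- The total violation of the three inequalities is continuous, nonnegative and zero exactly on
  -- `triangleSet`, so weak convergence transfers the vanishing of its integral.
  let v : I × I × I → ℝ := fun p => max 0 ((p.2.2 : ℝ) - p.1 - p.2.1) +
    (max 0 ((p.1 : ℝ) - p.2.1 - p.2.2) + max 0 ((p.2.1 : ℝ) - p.1 - p.2.2))
  have hvc : Continuous v := by fun_prop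
  have hv0 : ∀ p, 0 ≤ v p := fun p =>
    add_nonneg (le_max_left _ _) (add_nonneg (le_max_left _ _) (le_max_left _ _))
  have hv : ∀ p, v p = 0 ↔ p ∈ triangleSet := fun p => by
    have e : ∀ t : ℝ, max 0 t = 0 ↔ t ≤ 0 := fun t => max_eq_left_iff
    simp only [v, triangleSet, mem_ofPred_eq]
    rw [add_eq_zero_iff_of_nonneg (le_max_left _ _)
      (add_nonneg (le_max_left _ _) (le_max_left _ _)),
      add_eq_zero_iff_of_nonneg (le_max_left _ _) (le_max_left _ _), e, e, e]
    constructor <;> rintro ⟨h1, h2, h3⟩ <;> refine ⟨?_, ?_, ?_⟩ <;> linarith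
  let V : C(DistMatrix, ℝ) := ⟨fun m => v (sides m), hvc.comp continuous_sides⟩
  have hlim := ProbabilityMeasure.tendsto_iff_forall_integral_tendsto.1 h
    (BoundedContinuousFunction.mkOfCompact V)
  have hzero : ∀ n, ∫ m, BoundedContinuousFunction.mkOfCompact V m
      ∂((X n).sampling : Measure DistMatrix) = 0 := fun n => by
    refine (integral_map (X n).measurable_matrixOf.aemeasurable
      V.continuous.aestronglyMeasurable).trans ?_
    refine integral_eq_zero_of_ae (Eventually.of_forall fun x => ?_)
    refine (hv _).2 ⟨?_, ?_, ?_⟩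
    · exact dist_triangle (x 0) (x 1) (x 2)
    · have := dist_triangle (x 0) (x 2) (x 1)
      rw [dist_comm (x 2), add_comm] at this
      exact this
    · have := dist_triangle (x 1) (x 0) (x 2)
      rw [dist_comm (x 1) (x 0)] at this
      exact this
  simp only [hzero] at hlim
  have hint : ∫ m, V m ∂(qSampling μ d hd : Measure DistMatrix) = 0 :=
    (tendsto_nhds_unique hlim tendsto_const_nhds)
  have hae : ∀ᵐ m ∂(qSampling μ d hd : Measure DistMatrix), sides m ∈ triangleSet := by
    have := (integral_eq_zero_iff_of_nonneg (fun m => hv0 (sides m))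
      ((BoundedContinuousFunction.mkOfCompact V).integrable _)).1 hint
    exact this.mono fun m hm => (hv _).1 hm
  have h1 : ∀ᵐ x ∂Measure.infinitePi fun _ : ℕ => (μ : Measure Ω),
      ∀ᵐ m ∂matrixLaw (qMatrixOf d x), sides m ∈ triangleSet :=
    Measure.ae_ae_of_ae_bind
      (measurable_matrixLaw.comp (measurable_qMatrixOf hd)).aemeasurable hae
  have h2 : ∀ᵐ x ∂Measure.infinitePi fun _ : ℕ => (μ : Measure Ω),
      ∀ᵐ l ∂sideKernel hd (x 0, x 1, x 2), l ∈ triangleSet := by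
    filter_upwards [h1] with x hx
    have h3 := ae_of_ae_map measurable_assemble.aemeasurable hx
    rw [sideKernel_apply]
    have h4 := infinitePi_map_triple (fun p => (qMatrixOf d x p : Measure I))
      (a := pairIdx 0 1 (by norm_num)) (b := pairIdx 1 2 (by norm_num))
      (c := pairIdx 0 2 (by norm_num)) (by simp) (by simp) (by simp)
    refine h4 ▸ (ae_map_iff (Measurable.aemeasurable ?_) measurableSet_triangleSet).2 ?_
    · exact (measurable_pi_apply _).prodMk ((measurable_pi_apply _).prodMk (measurable_pi_apply _))
    · exact h3.mono fun l hl => hl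
  -- Measurability of the good triples, obtained by writing the side laws as a kernel, allows
  -- passing from sequences to their first three points.
  have hS : MeasurableSet {p : Ω × Ω × Ω | ∀ᵐ l ∂sideKernel hd p, l ∈ triangleSet} :=
    (Kernel.measurable_coe (sideKernel hd) measurableSet_triangleSet.compl)
      (measurableSet_singleton 0)
  have h5 := infinitePi_map_triple (fun _ : ℕ => (μ : Measure Ω)) (a := 0) (b := 1) (c := 2)
    (by norm_num) (by norm_num) (by norm_num)
  have h6 : ∀ᵐ p ∂(μ : Measure Ω).prod ((μ : Measure Ω).prod (μ : Measure Ω)),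
      ∀ᵐ l ∂sideKernel hd p, l ∈ triangleSet := by
    rw [← h5]
    refine (ae_map_iff (Measurable.aemeasurable ?_) hS).2 h2
    exact (measurable_pi_apply _).prodMk ((measurable_pi_apply _).prodMk (measurable_pi_apply _))
  filter_upwards [h6] with p hp
  rw [sideKernel_apply] at hp
  exact hp

end Triangle

/-! ### Transport to the Cantor space and correction on a null set -/

section Transfer

open ProbabilityTheory

variable {ω : Ultrafilter ℕ} [Nonprincipal ω] {X : ℕ → MMSpace}
  {dstar : UX2 ω X → ProbabilityMeasure I}

theorem not_countable_unitInterval : ¬Countable I := fun h => by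
  have h1 : Cardinal.mk I = Cardinal.continuum := Cardinal.mk_Icc_real zero_lt_one
  exact (Cardinal.aleph0_lt_continuum.trans_le h1.ge).not_ge (Cardinal.mk_le_aleph0_iff.2 h)

/-- The unit interval and the Cantor space are Borel isomorphic. -/
def cantorEquiv : I ≃ᵐ (ℕ → Bool) :=
  PolishSpace.measurableEquivNatBoolOfNotCountable not_countable_unitInterval

namespace SeparableRealization

variable (R : SeparableRealization dstar)

/-- The map of a separable realization, with values in the Cantor space. -/
def cantorMap (p : UX ω X) : ℕ → Bool := cantorEquiv (R.Ψ p)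

/-- The distance of a separable realization, transported to the Cantor space. -/
def cantorDist (s t : ℕ → Bool) : ProbabilityMeasure I :=
  R.d (cantorEquiv.symm s) (cantorEquiv.symm t)

theorem measurable_cantorMap : Measurable R.cantorMap :=
  cantorEquiv.measurable.comp R.measurable_Ψ

theorem measurable_cantorDist : Measurable (Function.uncurry R.cantorDist) :=
  R.measurable_d.comp (cantorEquiv.symm.measurable.prodMap cantorEquiv.symm.measurable)

theorem cantorDist_pullback :
    ∀ᵐ p : UX2 ω X, R.cantorDist (R.cantorMap (fstU p)) (R.cantorMap (sndU p)) = dstar p := by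
  filter_upwards [R.pullback_eq] with p hp
  simpa [cantorDist, cantorMap] using hp

theorem map_cantorMap :
    (volume : Measure (UX ω X)).map R.cantorMap = (R.μ : Measure I).map cantorEquiv :=
  (Measure.map_map cantorEquiv.measurable R.measurable_Ψ).symm

/-- The isomorphism with the Cantor space is only Borel, but `Ψ` and `d` are only measurable too,
and the limit integral depends on nothing more than the pushed forward measure and distance. -/
theorem tendsto_sampling (hdstar : IsDerivativeOfDist dstar) :
    Tendsto (fun n => (X n).sampling) (ω : Filter ℕ) (𝓝 (qSampling R.μ R.d R.measurable_d)) := by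
  obtain ⟨Φn, hΦn, hlift⟩ := exists_isLifting_cantor R.measurable_cantorMap
  refine tendsto_of_forall_integral_prod entry (fun m m' h => DistMatrix.ext_pairs h)
    fun s G hG => ?_
  simp only [integral_prod_entry_sampling, integral_prod_entry_qSampling]
  have key := tendsto_integral_prod_dist hdstar R.measurable_cantorMap hΦn hlift
    R.measurable_cantorDist R.cantorDist_pullback s G hG
  convert! key using 2
  have hm : Measurable fun (x : ℕ → I) (i : ℕ) => cantorEquiv (x i) :=
    measurable_pi_lambda _ fun i => cantorEquiv.measurable.comp (measurable_pi_apply i)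
  have hF : Measurable fun y : ℕ → ℕ → Bool => ∏ q ∈ s, pairFun R.cantorDist (G q) (pairAt y q) :=
    Finset.measurable_prod _ fun q _ =>
      (measurable_pairFun R.measurable_cantorDist _).comp (measurable_pairAt q)
  simp only [R.map_cantorMap]
  rw [← Measure.infinitePi_map_pi (fun _ : ℕ => (R.μ : Measure I))
    (fun _ => cantorEquiv.measurable), integral_map hm.aemeasurable hF.aestronglyMeasurable]
  simp [pairFun, pairAt, cantorDist]

theorem ae_symm (hdstar : IsDerivativeOfDist dstar) :
    ∀ᵐ p : I × I ∂((R.μ : Measure I).prod (R.μ : Measure I)), R.d p.1 p.2 = R.d p.2 p.1 := by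
  obtain ⟨Φn, hΦn, hlift⟩ := exists_isLifting_cantor R.measurable_cantorMap
  have key := ae_symm_of_isLifting hdstar R.measurable_cantorMap hΦn hlift
    R.measurable_cantorDist R.cantorDist_pullback
  rw [R.map_cantorMap, Measure.map_prod_map _ _ cantorEquiv.measurable
    cantorEquiv.measurable] at key
  have := ae_of_ae_map (cantorEquiv.measurable.prodMap cantorEquiv.measurable).aemeasurable key
  simpa [cantorDist] using this

end SeparableRealization

/-- The random triangle inequality is not affected by changes on null sets. -/
theorem RandomTriangle.congr_ae {Ω : Type*} [MeasurableSpace Ω] {μ : ProbabilityMeasure Ω}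
    {d d' : Ω → Ω → ProbabilityMeasure I} (h : RandomTriangle μ d)
    (hd : ∀ᵐ p : Ω × Ω ∂(μ : Measure Ω).prod (μ : Measure Ω), d' p.1 p.2 = d p.1 p.2) :
    RandomTriangle μ d' := by
  have hid := MeasurePreserving.id (μ : Measure Ω)
  -- Each projection of a triple to two of its points preserves the measure, so the null set pulls
  -- back to a null set of triples.
  have h12 := ((hid.prod (measurePreserving_fst (μ := (μ : Measure Ω))
    (ν := (μ : Measure Ω)))).quasiMeasurePreserving).ae hd
  have h13 := ((hid.prod (measurePreserving_snd (μ := (μ : Measure Ω))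
    (ν := (μ : Measure Ω)))).quasiMeasurePreserving).ae hd
  have h23 := (measurePreserving_snd (μ := (μ : Measure Ω))
    (ν := (μ : Measure Ω).prod (μ : Measure Ω))).quasiMeasurePreserving.ae hd
  filter_upwards [h, h12, h13, h23] with p hp e12 e13 e23
  simp only [Prod.map_fst, Prod.map_snd, id] at e12 e13 e23
  rw [e12, e13, e23]
  exact hp

/-- The symmetric function that is `δ_0` on the diagonal and agrees with `d` where `x < y`. -/
def symmetrize (d : I → I → ProbabilityMeasure I) (x y : I) : ProbabilityMeasure I :=
  if x = y then diracI 0 else if x < y then d x y else d y x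

theorem symmetrize_comm (d : I → I → ProbabilityMeasure I) (x y : I) :
    symmetrize d x y = symmetrize d y x := by
  rcases lt_trichotomy x y with h | h | h
  · simp [symmetrize, h.ne, h.ne', h, h.not_gt]
  · simp [h]
  · simp [symmetrize, h.ne, h.ne', h, h.not_gt]

theorem measurable_symmetrize {d : I → I → ProbabilityMeasure I}
    (hd : Measurable (Function.uncurry d)) : Measurable (Function.uncurry (symmetrize d)) := by
  refine Measurable.ite (measurableSet_eq_fun measurable_fst measurable_snd) measurable_const ?_
  exact Measurable.ite (measurableSet_lt measurable_fst measurable_snd) hd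
    (hd.comp measurable_swap)

/-- Almost every point of the diagonal is a pair of atoms. -/
theorem ae_diag_imp_atom {Ω : Type*} [MeasurableSpace Ω] [MeasurableEq Ω] (μ : Measure Ω)
    [SFinite μ] : ∀ᵐ p : Ω × Ω ∂μ.prod μ, p.1 = p.2 → μ {p.1} ≠ 0 := by
  have hA : MeasurableSet {x : Ω | μ {x} = 0} := by
    have := measurable_measure_prodMk_left (ν := μ) (measurableSet_diagonal (α := Ω))
    convert! this (measurableSet_singleton 0) using 1
    ext x
    have : Prod.mk x ⁻¹' Set.diagonal Ω = {x} := by ext y; simp [eq_comm]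
    simp [this]
  have hB : MeasurableSet (Set.diagonal Ω ∩ Prod.fst ⁻¹' {x : Ω | μ {x} = 0}) :=
    measurableSet_diagonal.inter (measurable_fst hA)
  -- By Fubini: the section over `x` lies in `{x}` if `x` is not an atom, and is empty otherwise.
  have h0 : (μ.prod μ) (Set.diagonal Ω ∩ Prod.fst ⁻¹' {x : Ω | μ {x} = 0}) = 0 := by
    rw [Measure.measure_prod_null hB]
    refine Eventually.of_forall fun x => ?_
    by_cases hx : μ {x} = 0
    · refine measure_mono_null (fun y hy => ?_) hx
      exact (mem_diagonal_iff.1 hy.1).symm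
    · convert! measure_empty (μ := μ)
      ext y
      simp [hx]
  filter_upwards [compl_mem_ae_iff.2 h0] with p hp he hz
  exact hp ⟨he, hz⟩

end Transfer

end UltraMM

end

theorem mainTheorem6 (ω : Ultrafilter ℕ) [UltraMM.Nonprincipal ω] (X : ℕ → UltraMM.MMSpace)
    (dstar : UltraMM.UX2 ω X → ProbabilityMeasure I) (hdstar : UltraMM.IsDerivativeOfDist dstar)
    (R : UltraMM.SeparableRealization dstar) :
    Tendsto (fun n => (X n).sampling) (ω : Filter ℕ) (𝓝 (UltraMM.qSampling R.μ R.d R.measurable_d)) ∧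
    (∀ᵐ p : I × I ∂((R.μ : Measure I).prod (R.μ : Measure I)), R.d p.1 p.2 = R.d p.2 p.1) ∧
    UltraMM.RandomTriangle R.μ R.d ∧
    ((∀ x, R.d x x = UltraMM.diracI 0) → (∀ x y, R.d x y = R.d y x) → UltraMM.IsQMM R.μ R.d) ∧
    ((∀ x, (R.μ : Measure I) {x} ≠ 0 → R.d x x = UltraMM.diracI 0) →
      ∃ d' : I → I → ProbabilityMeasure I,
        (∀ᵐ p : I × I ∂((R.μ : Measure I).prod (R.μ : Measure I)), d' p.1 p.2 = R.d p.1 p.2) ∧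
        UltraMM.IsQMM R.μ d') := by
  have hlim := R.tendsto_sampling hdstar
  have hsymm := R.ae_symm hdstar
  have htri := UltraMM.randomTriangle_of_tendsto hlim
  refine ⟨hlim, hsymm, htri, fun hdiag hs => ⟨R.measurable_d, hdiag, hs, htri⟩, fun hatom => ?_⟩
  -- Above the diagonal nothing changes, below it the change is null by almost everywhere symmetry,
  -- and on it only pairs of atoms have positive measure, where `hatom` applies.
  have hd' : ∀ᵐ p : I × I ∂((R.μ : Measure I).prod (R.μ : Measure I)),
      UltraMM.symmetrize R.d p.1 p.2 = R.d p.1 p.2 := by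
    filter_upwards [hsymm, UltraMM.ae_diag_imp_atom (R.μ : Measure I)] with p hp ha
    rcases lt_trichotomy p.1 p.2 with h | h | h
    · simp [UltraMM.symmetrize, h.ne, h]
    · rw [← h, hatom _ (ha h)]
      simp [UltraMM.symmetrize]
    · simp [UltraMM.symmetrize, h.ne', h.not_gt, hp]
  exact ⟨UltraMM.symmetrize R.d, hd', UltraMM.measurable_symmetrize R.measurable_d,
    fun x => by simp [UltraMM.symmetrize], UltraMM.symmetrize_comm R.d, htri.congr_ae hd'⟩
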